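/- Fix $K\in\mathbb N$, a true parameter $\beta\in\mathbb R^K$, a known $\sigma>0$, a prior mean $\theta_0\in\mathbb R^K$ and a positive definite prior covariance $\Sigma_0\in\mathbb R^{K\times K}$. Let $x_0,x_1,\dots$ be i.i.d. random vectors in $\mathbb R^K$ with $\mathrm E[x_nx_n^\top]=A$, where $A$ is positive definite, such that almost surely $0<\inf_n\|x_n\|_1\le\sup_n\|x_n\|_1<\infty$. Let $\tau_n>0$ be (possibly random) censoring times such that, almost surely, the sequence $(\log\tau_n)_{n\ge0}$ is bounded. The lifetimes $T_n$ satisfy the log-normal model $y_n:=\log T_n=x_n^\top\beta+\varepsilon_n$ for $n\ge1$, where $\varepsilon_n\sim N(0,\sigma^2)$ and, for each $n\ge0$, $\varepsilon_{n+1}$ is independent of the $\sigma$-algebra generated by $x_1,\dots,x_{n+1},\tau_1,\dots,\tau_{n+1},\varepsilon_1,\dots,\varepsilon_n$. Let $\delta_n=1$ if $T_n\le\tau_n$ (failure observed) and $\delta_n=0$ if $T_n>\tau_n$ (censored). Let $\phi$ and $\Phi$ be the standard normal density and distribution function, and define $\Sigma_n$, $\theta_n$ recursively, for $n\ge0$,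 by $$\Sigma_{n+1}^{-1}=\Sigma_n^{-1}+\frac1{\sigma^2}x_{n+1}x_{n+1}^\top,$$ $$\theta_{n+1}=\theta_n+\delta_{n+1}\frac{y_{n+1}-x_{n+1}^\top\theta_n}{\sigma^2}\,\Sigma_{n+1}x_{n+1}+(1-\delta_{n+1})\frac{\phi(\eta_n)\sqrt{\sigma^2+x_{n+1}^\top\Sigma_nx_{n+1}}}{(1-\Phi(\eta_n))\,\sigma^2}\,\Sigma_{n+1}x_{n+1},$$ where $$\eta_n=\frac{\log\tau_{n+1}-x_{n+1}^\top\theta_n}{\sqrt{\sigma^2+x_{n+1}^\top\Sigma_nx_{n+1}}}.$$ Then $\theta_n\to\beta$ almost surely. -/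

import Mathlib

open MeasureTheory ProbabilityTheory Filter Topology
open scoped Matrix

namespace CensoredLogNormal

noncomputable section

/-- Density `φ` of the standard normal distribution. -/
def stdPDF (t : ℝ) : ℝ := gaussianPDFReal 0 1 t

/-- Cumulative distribution function `Φ` of the standard normal distribution. -/
def stdCDF (t : ℝ) : ℝ := cdf (gaussianReal 0 1) t

/-- The `ℓ¹` norm of a vector. -/
def l1Norm {K : ℕ} (v : Fin K → ℝ) : ℝ := ∑ i, |v i|

/-- The second moment matrix `E[X Xᵀ]` of a random vector. -/
def secondMoment {Ω : Type*} [MeasurableSpace Ω] (μ : Measure Ω) {K : ℕ}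
    (X : Ω → Fin K → ℝ) : Matrix (Fin K) (Fin K) ℝ :=
  Matrix.of fun i j => ∫ ω, X ω i * X ω j ∂μ

/-- The lifetime `T`, given by `log T = xᵀ β + ε`. -/
def lifetime {K : ℕ} (β x : Fin K → ℝ) (ε : ℝ) : ℝ := Real.exp (x ⬝ᵥ β + ε)

/-- The failure indicator `δ`: it is `1` if the failure is observed by the censoring time `τ`,
and `0` if the lifetime `T` exceeds `τ`. -/
def failureIndicator (T τ : ℝ) : ℝ := if T ≤ τ then 1 else 0

/-- The posterior precision matrices `Σₙ⁻¹`: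
`Σₙ₊₁⁻¹ = Σₙ⁻¹ + σ⁻² xₙ₊₁ xₙ₊₁ᵀ`, started from `Σ₀⁻¹`. -/
def precision {K : ℕ} (σ : ℝ) (S₀ : Matrix (Fin K) (Fin K) ℝ) (x : ℕ → Fin K → ℝ) :
    ℕ → Matrix (Fin K) (Fin K) ℝ
  | 0 => S₀⁻¹
  | n + 1 => precision σ S₀ x n + (1 / σ ^ 2) • Matrix.vecMulVec (x (n + 1)) (x (n + 1))

/-- The posterior covariance matrices `Σₙ`. -/
def covMatrix {K : ℕ} (σ : ℝ) (S₀ : Matrix (Fin K) (Fin K) ℝ) (x : ℕ → Fin K → ℝ) (n : ℕ) :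
    Matrix (Fin K) (Fin K) ℝ :=
  (precision σ S₀ x n)⁻¹

/-- The predictive standard deviation `√(σ² + xᵀ S x)`. -/
def predictiveSD {K : ℕ} (σ : ℝ) (S : Matrix (Fin K) (Fin K) ℝ) (x : Fin K → ℝ) : ℝ :=
  Real.sqrt (σ ^ 2 + x ⬝ᵥ (S *ᵥ x))

/-- The standardized log censoring time `η = (log τ - xᵀ θ) / √(σ² + xᵀ S x)`. -/
def stdThreshold {K : ℕ} (σ : ℝ) (S : Matrix (Fin K) (Fin K) ℝ) (θ x : Fin K → ℝ) (τ : ℝ) : ℝ :=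
  (Real.log τ - x ⬝ᵥ θ) / predictiveSD σ S x

/-- The posterior means `θₙ` of the approximate Bayesian procedure along one sample path of
designs `x`, censoring times `τ` and lifetimes `T`. With `δₙ₊₁` the failure indicator,
`yₙ₊₁ = log Tₙ₊₁` and `ηₙ` the standardized threshold,
`θₙ₊₁ = θₙ + δₙ₊₁ (yₙ₊₁ - xₙ₊₁ᵀ θₙ) / σ² • Σₙ₊₁ xₙ₊₁`
`  + (1 - δₙ₊₁) φ(ηₙ) √(σ² + xₙ₊₁ᵀ Σₙ xₙ₊₁) / ((1 - Φ(ηₙ)) σ²) • Σₙ₊₁ xₙ₊₁`. -/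
def posteriorMean {K : ℕ} (σ : ℝ) (θ₀ : Fin K → ℝ) (S₀ : Matrix (Fin K) (Fin K) ℝ)
    (x : ℕ → Fin K → ℝ) (τ T : ℕ → ℝ) : ℕ → Fin K → ℝ
  | 0 => θ₀
  | n + 1 =>
    let θ := posteriorMean σ θ₀ S₀ x τ T n
    let S := covMatrix σ S₀ x n
    let gain := covMatrix σ S₀ x (n + 1) *ᵥ x (n + 1)
    let δ := failureIndicator (T (n + 1)) (τ (n + 1))
    let η := stdThreshold σ S θ (x (n + 1)) (τ (n + 1))
    θ + (δ * ((Real.log (T (n + 1)) - x (n + 1) ⬝ᵥ θ) / σ ^ 2)) • gain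
      + ((1 - δ) * (stdPDF η * predictiveSD σ S (x (n + 1)) / ((1 - stdCDF η) * σ ^ 2))) • gain

/-- The information available just before the `(n+1)`-st failure time is observed: the sigma-algebra
generated by `x₁, …, xₙ₊₁`, `τ₁, …, τₙ₊₁` and `ε₁, …, εₙ`. All of
`θ₁, …, θₙ`, `Σ₁, …, Σₙ`, `y₁, …, yₙ`, `δ₁, …, δₙ` are functions of these variables. -/
@[reducible] def history {Ω : Type*} {K : ℕ} (x : ℕ → Ω → Fin K → ℝ) (τ ε : ℕ → Ω → ℝ) (n : ℕ) :
    MeasurableSpace Ω :=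
  (⨆ k ∈ Set.Icc 1 (n + 1), MeasurableSpace.comap (x k) inferInstance)
    ⊔ (⨆ k ∈ Set.Icc 1 (n + 1), MeasurableSpace.comap (τ k) inferInstance)
    ⊔ (⨆ k ∈ Set.Icc 1 n, MeasurableSpace.comap (ε k) inferInstance)

end

end CensoredLogNormal

/-! Write e_n = θ_n − β, P_n = Σ_n⁻¹ and w = x_{n+1}·e_n. One step adds (g/σ²) P_{n+1}⁻¹ x_{n+1} to
e_n, where the innovation g (`score`) depends on the past and on one fresh standard normal error.
The normal hazard rate is increasing and 1-Lipschitz, so if σ replaced the predictive standard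
deviation s, the conditional mean of g would be −ρw with Φ(α) ≤ ρ ≤ 1, α being the standardized
censoring level. Bounded designs and log censoring times keep Φ(α) ≥ κ > 0, and using s costs a bias
of order s − σ = O(1/n) (`exists_integral_score_eq`).

By the strong law P_n/n → Q = A/σ², so the gain is about Q⁻¹x/n and eᵀQe drifts by about
−2ρw²/(σ²n). This controls only the direction x_{n+1}, and x_{n+1} cannot be averaged out, because
designs may depend on past errors. The term (κ/n) eᵀP_n e of `lyapunov` repairs this. Its update
adds κw²/(σ²(n+1)), which the drift of eᵀQe pays for, while the larger divisor removes a multiple of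
|e|²/n in every direction. Hence `exists_contraction`: the conditional mean of the Lyapunov function
shrinks by 1 − c/(n+1), up to D/(n+1)².

As ∑ 1/n diverges and ∑ 1/n² converges, a supermartingale argument
(`ae_tendsto_zero_of_contraction`) sends such a process to zero. Bounds and closeness to Q hold only
with random constants and from a random time on, so the argument runs on indicators of `goodEvent`;
countably many of these families cover almost every path. -/

namespace CensoredLogNormal

/-! ### Standard normal density, distribution function and truncated moments -/

lemma stdPDF_eq (t : ℝ) : stdPDF t = (Real.sqrt (2 * Real.pi))⁻¹ * Real.exp (-(1 / 2) * t ^ 2) := by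
  simp only [stdPDF, gaussianPDFReal]
  congr 2
  · simp
  · simp; ring

lemma stdPDF_pos (t : ℝ) : 0 < stdPDF t := gaussianPDFReal_pos 0 1 t one_ne_zero

lemma hasDerivAt_stdPDF (t : ℝ) : HasDerivAt stdPDF (-(t * stdPDF t)) t := by
  have h : stdPDF = fun t => (Real.sqrt (2 * Real.pi))⁻¹ * Real.exp (-(1 / 2) * t ^ 2) :=
    funext stdPDF_eq
  rw [h]
  have h1 : HasDerivAt (fun t : ℝ => -(1 / 2) * t ^ 2) (-t) t := by
    refine ((hasDerivAt_pow 2 t).const_mul (-(1 / 2) : ℝ)).congr_deriv ?_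
    norm_num
    ring
  refine (h1.exp.const_mul (Real.sqrt (2 * Real.pi))⁻¹).congr_deriv ?_
  ring

lemma continuous_stdPDF : Continuous stdPDF :=
  continuous_iff_continuousAt.2 fun t => (hasDerivAt_stdPDF t).continuousAt

lemma integrable_stdPDF : Integrable stdPDF := integrable_gaussianPDFReal 0 1

lemma integrable_mul_stdPDF : Integrable fun t => t * stdPDF t := by
  have h := (integrable_mul_exp_neg_mul_sq (b := 1 / 2) (by norm_num)).const_mul
    (Real.sqrt (2 * Real.pi))⁻¹
  refine h.congr (Eventually.of_forall fun t => ?_)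
  simp only [stdPDF_eq]; ring

lemma integrable_sq_mul_stdPDF : Integrable fun t => t ^ 2 * stdPDF t := by
  have h := (integrable_rpow_mul_exp_neg_mul_sq (b := 1 / 2) (by norm_num) (s := 2)
    (by norm_num)).const_mul (Real.sqrt (2 * Real.pi))⁻¹
  refine h.congr (Eventually.of_forall fun t => ?_)
  simp only [stdPDF_eq, Real.rpow_two]; ring

lemma tendsto_stdPDF_atTop : Tendsto stdPDF atTop (𝓝 0) := by
  have h := (rpow_mul_exp_neg_mul_sq_isLittleO_exp_neg (b := 1 / 2) (by norm_num) 0).trans_tendsto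
    (Real.tendsto_exp_atBot.comp (tendsto_id.const_mul_atTop_of_neg (by norm_num : -(1 / 2 : ℝ) < 0)))
  have h2 := h.const_mul (Real.sqrt (2 * Real.pi))⁻¹
  rw [mul_zero] at h2
  refine h2.congr fun t => ?_
  simp [stdPDF_eq]

lemma tendsto_mul_stdPDF_atTop : Tendsto (fun t => t * stdPDF t) atTop (𝓝 0) := by
  have h := (rpow_mul_exp_neg_mul_sq_isLittleO_exp_neg (b := 1 / 2) (by norm_num) 1).trans_tendsto
    (Real.tendsto_exp_atBot.comp (tendsto_id.const_mul_atTop_of_neg (by norm_num : -(1 / 2 : ℝ) < 0)))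
  have h2 := h.const_mul (Real.sqrt (2 * Real.pi))⁻¹
  rw [mul_zero] at h2
  refine h2.congr fun t => ?_
  simp only [stdPDF_eq, Real.rpow_one]; ring

lemma integral_Ioi_mul_stdPDF (a : ℝ) : ∫ t in Set.Ioi a, t * stdPDF t = stdPDF a := by
  have h := integral_Ioi_of_hasDerivAt_of_tendsto (f := fun t => -stdPDF t)
    (f' := fun t => t * stdPDF t) (a := a) (m := 0)
    continuous_stdPDF.neg.continuousWithinAt
    (fun t _ => (hasDerivAt_stdPDF t).fun_neg.congr_deriv (neg_neg _)) integrable_mul_stdPDF.integrableOn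
    (by simpa using tendsto_stdPDF_atTop.neg)
  simpa using h

lemma stdCDF_eq_integral (a : ℝ) : stdCDF a = ∫ t in Set.Iic a, stdPDF t := by
  rw [stdCDF, cdf_eq_real, measureReal_def, gaussianReal_apply_eq_integral 0 one_ne_zero,
    ENNReal.toReal_ofReal]
  · rfl
  · exact integral_nonneg fun t => (stdPDF_pos t).le

lemma integral_stdPDF : ∫ t, stdPDF t = 1 := integral_gaussianPDFReal_eq_one 0 one_ne_zero

lemma one_sub_stdCDF_eq_integral (a : ℝ) : 1 - stdCDF a = ∫ t in Set.Ioi a, stdPDF t := by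
  have h := intervalIntegral.integral_Iic_add_Ioi (μ := volume) (b := a)
    integrable_stdPDF.integrableOn integrable_stdPDF.integrableOn
  rw [integral_stdPDF, ← stdCDF_eq_integral] at h
  linarith

lemma integral_Ioi_sq_mul_stdPDF (a : ℝ) :
    ∫ t in Set.Ioi a, t ^ 2 * stdPDF t = a * stdPDF a + (1 - stdCDF a) := by
  have h := integral_Ioi_of_hasDerivAt_of_tendsto (f := fun t => -(t * stdPDF t))
    (f' := fun t => t ^ 2 * stdPDF t - stdPDF t) (a := a) (m := 0)
    (continuous_id.mul continuous_stdPDF).neg.continuousWithinAt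
    (fun t _ => ((hasDerivAt_id t).mul (hasDerivAt_stdPDF t)).fun_neg.congr_deriv (by
      simp only [id]; ring))
    (integrable_sq_mul_stdPDF.sub integrable_stdPDF).integrableOn
    (by simpa using tendsto_mul_stdPDF_atTop.neg)
  rw [integral_sub integrable_sq_mul_stdPDF.integrableOn integrable_stdPDF.integrableOn,
    ← one_sub_stdCDF_eq_integral] at h
  linarith

lemma hasDerivAt_stdCDF (a : ℝ) : HasDerivAt stdCDF (stdPDF a) a := by
  have h : stdCDF = fun b => stdCDF 0 + ∫ t in (0 : ℝ)..b, stdPDF t := by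
    funext b
    rw [← intervalIntegral.integral_Iic_sub_Iic integrable_stdPDF.integrableOn
      integrable_stdPDF.integrableOn, ← stdCDF_eq_integral, ← stdCDF_eq_integral]
    ring
  rw [h]
  exact (intervalIntegral.integral_hasDerivAt_right integrable_stdPDF.intervalIntegrable
    continuous_stdPDF.stronglyMeasurable.stronglyMeasurableAtFilter
    continuous_stdPDF.continuousAt).const_add _

lemma stdCDF_lt_one (a : ℝ) : stdCDF a < 1 := by
  have h : 0 < ∫ t in Set.Ioi a, stdPDF t := by
    rw [setIntegral_pos_iff_support_of_nonneg_ae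
      (Eventually.of_forall fun t => (stdPDF_pos t).le) integrable_stdPDF.integrableOn]
    have : Function.support stdPDF = Set.univ := by
      ext t; simp [(stdPDF_pos t).ne']
    simp [this]
  rw [← one_sub_stdCDF_eq_integral] at h
  linarith

lemma stdCDF_pos (a : ℝ) : 0 < stdCDF a := by
  have h : 0 < ∫ t in Set.Iic a, stdPDF t := by
    rw [setIntegral_pos_iff_support_of_nonneg_ae
      (Eventually.of_forall fun t => (stdPDF_pos t).le) integrable_stdPDF.integrableOn]
    have : Function.support stdPDF = Set.univ := by
      ext t; simp [(stdPDF_pos t).ne']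
    simp [this]
  rwa [stdCDF_eq_integral]

lemma stdCDF_mono : Monotone stdCDF := monotone_cdf _

/-! ### The hazard rate is increasing and 1-Lipschitz -/

noncomputable section

/-- The hazard rate `φ / (1 - Φ)` of the standard normal distribution. -/
def hazard (t : ℝ) : ℝ := stdPDF t / (1 - stdCDF t)

lemma hazard_pos (t : ℝ) : 0 < hazard t := div_pos (stdPDF_pos t) (by linarith [stdCDF_lt_one t])

lemma hazard_mul (t : ℝ) : hazard t * (1 - stdCDF t) = stdPDF t :=
  div_mul_cancel₀ _ (by linarith [stdCDF_lt_one t])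

/-- `hazard a` is the mean of a standard normal conditioned to exceed `a`: integrating (t − a)φ(t) ≥
0 over t > a gives φ(a) ≥ a(1 − Φ(a)). -/
lemma le_hazard (a : ℝ) : a ≤ hazard a := by
  have h : 0 ≤ ∫ t in Set.Ioi a, (t * stdPDF t - a * stdPDF t) :=
    setIntegral_nonneg measurableSet_Ioi fun t ht => by
      rw [← sub_mul]
      exact mul_nonneg (sub_nonneg.2 (le_of_lt ht)) (stdPDF_pos t).le
  rw [integral_sub integrable_mul_stdPDF.integrableOn (integrable_stdPDF.const_mul a).integrableOn,
    integral_const_mul, integral_Ioi_mul_stdPDF, ← one_sub_stdCDF_eq_integral] at h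
  rw [hazard, le_div_iff₀ (by linarith [stdCDF_lt_one a])]
  linarith

/-- The variance of the truncated normal distribution is nonnegative. -/
lemma hazard_mul_sub_le_one (a : ℝ) : hazard a * (hazard a - a) ≤ 1 := by
  -- `c` is the mean of the normal truncated to (a, ∞); the integral of (t − c)²φ equals (1 − c(c −
  -- a))(1 − Φ(a)).
  set c := hazard a with hc
  have h : 0 ≤ ∫ t in Set.Ioi a, (t ^ 2 * stdPDF t - 2 * c * (t * stdPDF t) + c ^ 2 * stdPDF t) :=
    setIntegral_nonneg measurableSet_Ioi fun t _ => by
      have : t ^ 2 * stdPDF t - 2 * c * (t * stdPDF t) + c ^ 2 * stdPDF t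
          = (t - c) ^ 2 * stdPDF t := by ring
      rw [this]
      exact mul_nonneg (sq_nonneg _) (stdPDF_pos t).le
  have hi : Integrable fun t => t ^ 2 * stdPDF t - 2 * c * (t * stdPDF t) :=
    integrable_sq_mul_stdPDF.sub (integrable_mul_stdPDF.const_mul (2 * c))
  rw [integral_add hi.integrableOn
      (integrable_stdPDF.const_mul (c ^ 2)).integrableOn,
    integral_sub integrable_sq_mul_stdPDF.integrableOn
      (integrable_mul_stdPDF.const_mul (2 * c)).integrableOn,
    integral_const_mul, integral_const_mul, integral_Ioi_mul_stdPDF, integral_Ioi_sq_mul_stdPDF,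
    ← one_sub_stdCDF_eq_integral, ← hazard_mul, ← hc] at h
  have hQ : 0 < 1 - stdCDF a := by linarith [stdCDF_lt_one a]
  have : 0 ≤ (1 - c * (c - a)) * (1 - stdCDF a) := by nlinarith
  have := nonneg_of_mul_nonneg_left this hQ
  linarith

lemma hasDerivAt_hazard (a : ℝ) : HasDerivAt hazard (hazard a * (hazard a - a)) a := by
  have hQ : 1 - stdCDF a ≠ 0 := by linarith [stdCDF_lt_one a]
  have h := (hasDerivAt_stdPDF a).div ((hasDerivAt_stdCDF a).const_sub 1) hQ
  refine h.congr_deriv ?_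
  simp only [hazard]
  field_simp
  ring

lemma hazard_mono : Monotone hazard :=
  monotone_of_hasDerivAt_nonneg hasDerivAt_hazard fun a =>
    mul_nonneg (hazard_pos a).le (sub_nonneg.2 (le_hazard a))

/-- The derivative h(h − t) of the hazard is one minus the truncated variance, hence at most 1, so t
− h(t) is increasing. -/
lemma hazard_sub_le {a b : ℝ} (hab : a ≤ b) : hazard b - hazard a ≤ b - a := by
  have h : Monotone fun t => t - hazard t :=
    monotone_of_hasDerivAt_nonneg (fun a => (hasDerivAt_id a).sub (hasDerivAt_hazard a)) fun a => by
      simpa using hazard_mul_sub_le_one a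
  have := h hab
  simp only at this
  linarith

lemma abs_hazard_sub_le (a b : ℝ) : |hazard a - hazard b| ≤ |a - b| := by
  rcases le_total a b with h | h
  · rw [abs_sub_comm, abs_sub_comm a, abs_of_nonneg (sub_nonneg.2 (hazard_mono h)),
      abs_of_nonneg (sub_nonneg.2 h)]
    exact hazard_sub_le h
  · rw [abs_of_nonneg (sub_nonneg.2 (hazard_mono h)), abs_of_nonneg (sub_nonneg.2 h)]
    exact hazard_sub_le h

lemma hazard_le (a : ℝ) : hazard a ≤ hazard 0 + |a| := by
  have := abs_le.1 (abs_hazard_sub_le a 0)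
  simp only [sub_zero] at this
  linarith [this.2]

/-! ### Mean and second moment of the innovation -/

lemma integral_mul_stdPDF : ∫ t, t * stdPDF t = 0 := by
  have h := integral_id_gaussianReal (μ := 0) (v := 1)
  rw [integral_gaussianReal_eq_integral_smul one_ne_zero] at h
  rw [← h]
  exact integral_congr_ae (Eventually.of_forall fun t => mul_comm _ _)

lemma integral_Iic_mul_stdPDF (a : ℝ) : ∫ t in Set.Iic a, t * stdPDF t = -stdPDF a := by
  have h := intervalIntegral.integral_Iic_add_Ioi (μ := volume) (b := a)
    integrable_mul_stdPDF.integrableOn integrable_mul_stdPDF.integrableOn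
  rw [integral_mul_stdPDF, integral_Ioi_mul_stdPDF] at h
  linarith

/-- The innovation of the posterior mean when the standardized error is `z`, the standardized
log censoring time is `α`, the prediction error is `w` and the predictive standard deviation
is `s`. -/
def score (σ α w s z : ℝ) : ℝ := if z ≤ α then σ * z - w else s * hazard ((σ * α - w) / s)

lemma memLp_id_stdGaussian : MemLp (fun z : ℝ => z) 2 (gaussianReal 0 1) :=
  memLp_id_gaussianReal 2

lemma memLp_score (σ α w s : ℝ) : MemLp (score σ α w s) 2 (gaussianReal 0 1) := by
  have h1 : MemLp (fun z => σ * z - w) 2 (gaussianReal 0 1) :=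
    (memLp_id_stdGaussian.const_mul σ).sub (memLp_const w)
  have h2 : MemLp (fun _ : ℝ => s * hazard ((σ * α - w) / s)) 2 (gaussianReal 0 1) :=
    memLp_const _
  have h := MemLp.piecewise (s := Set.Iic α) measurableSet_Iic (h1.restrict _) (h2.restrict _)
  exact h

lemma integrable_score (σ α w s : ℝ) : Integrable (score σ α w s) (gaussianReal 0 1) :=
  (memLp_score σ α w s).integrable (by norm_num)

lemma integrable_score_sq (σ α w s : ℝ) :
    Integrable (fun z => score σ α w s z ^ 2) (gaussianReal 0 1) :=
  (memLp_score σ α w s).integrable_sq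

/-- The uncensored part contributes −σφ(α) − wΦ(α), with φ = h(1 − Φ); the censored part is
constant. For s = σ and w = 0 the two cancel: the exact score is centred at the truth. -/
lemma integral_score (σ α w s : ℝ) :
    ∫ z, score σ α w s z ∂gaussianReal 0 1 = -(stdCDF α * w)
      + (1 - stdCDF α) * (s * hazard ((σ * α - w) / s) - σ * hazard α) := by
  have hi : Integrable fun z => stdPDF z * score σ α w s z := by
    have h1 : Integrable fun z => σ * (z * stdPDF z) - w * stdPDF z :=
      (integrable_mul_stdPDF.const_mul σ).sub (integrable_stdPDF.const_mul w)
    have h2 : Integrable fun z => s * hazard ((σ * α - w) / s) * stdPDF z :=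
      integrable_stdPDF.const_mul _
    refine (Integrable.piecewise (s := Set.Iic α) measurableSet_Iic h1.integrableOn
      h2.integrableOn).congr (Eventually.of_forall fun z => ?_)
    by_cases hz : z ≤ α
    · simp [score, hz]; ring
    · simp [score, hz]; ring
  rw [integral_gaussianReal_eq_integral_smul one_ne_zero]
  change ∫ z, stdPDF z * score σ α w s z = _
  rw [← intervalIntegral.integral_Iic_add_Ioi (b := α) hi.integrableOn hi.integrableOn]
  have e1 : ∫ z in Set.Iic α, stdPDF z * score σ α w s z
      = ∫ z in Set.Iic α, (σ * (z * stdPDF z) - w * stdPDF z) :=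
    setIntegral_congr_fun measurableSet_Iic fun z (hz : z ≤ α) => by
      simp only [score, hz, if_true]; ring
  have e2 : ∫ z in Set.Ioi α, stdPDF z * score σ α w s z
      = ∫ z in Set.Ioi α, s * hazard ((σ * α - w) / s) * stdPDF z :=
    setIntegral_congr_fun measurableSet_Ioi fun z (hz : α < z) => by
      simp only [score, not_le.2 hz, if_false]; ring
  rw [e1, e2, integral_sub (integrable_mul_stdPDF.const_mul σ).integrableOn
    (integrable_stdPDF.const_mul w).integrableOn, integral_const_mul, integral_const_mul,
    integral_const_mul, integral_Iic_mul_stdPDF, ← stdCDF_eq_integral,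
    ← one_sub_stdCDF_eq_integral, ← hazard_mul]
  ring

/-- Changing the standard deviation in the rescaled hazard costs at most the change times
a linear function of the argument. -/
lemma abs_scaled_hazard_sub_le {σ s : ℝ} (hσ : 0 < σ) (hs : σ ≤ s) (v : ℝ) :
    |s * hazard (v / s) - σ * hazard (v / σ)| ≤ (s - σ) * (hazard 0 + 2 * |v| / σ) := by
  have hs0 : 0 < s := hσ.trans_le hs
  -- Separates the change of the prefactor, bounded by linear growth of the hazard, from the change
  -- of its argument, bounded by its Lipschitz constant.
  have e : s * hazard (v / s) - σ * hazard (v / σ)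
      = (s - σ) * hazard (v / s) + σ * (hazard (v / s) - hazard (v / σ)) := by ring
  have h1 : |hazard (v / s)| ≤ hazard 0 + |v| / σ := by
    rw [abs_of_pos (hazard_pos _)]
    refine (hazard_le _).trans ?_
    rw [abs_div, abs_of_pos hs0]
    gcongr
  have h2 : σ * |hazard (v / s) - hazard (v / σ)| ≤ (s - σ) * (|v| / σ) := by
    have h3 : σ * |v / s - v / σ| ≤ (s - σ) * (|v| / σ) := by
      have e3 : v / s - v / σ = -((s - σ) * v / (s * σ)) := by field_simp; ring
      rw [e3, abs_neg, abs_div, abs_mul, abs_of_nonneg (sub_nonneg.2 hs),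
        abs_of_pos (mul_pos hs0 hσ)]
      have : σ * ((s - σ) * |v| / (s * σ)) = (s - σ) * (|v| / s) := by field_simp
      rw [this]
      have := sub_nonneg.2 hs
      gcongr
    exact (mul_le_mul_of_nonneg_left (abs_hazard_sub_le _ _) hσ.le).trans h3
  rw [e]
  refine (abs_add_le _ _).trans ?_
  rw [abs_mul, abs_mul, abs_of_nonneg (sub_nonneg.2 hs), abs_of_pos hσ]
  have := mul_le_mul_of_nonneg_left h1 (sub_nonneg.2 hs)
  calc _ ≤ (s - σ) * (hazard 0 + |v| / σ) + (s - σ) * (|v| / σ) := add_le_add this h2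
    _ = _ := by ring

/-- The mean score is `-ρ w + b` with `Φ(α) ≤ ρ ≤ 1` and a bias `b` of order `s - σ`. -/
lemma exists_integral_score_eq {σ s : ℝ} (hσ : 0 < σ) (hs : σ ≤ s) (α w : ℝ) :
    ∃ b, |b| ≤ (s - σ) * (hazard 0 + 2 * |σ * α - w| / σ) ∧
      w * (∫ z, score σ α w s z ∂gaussianReal 0 1) ≤ -(stdCDF α * w ^ 2) + w * b ∧
      |∫ z, score σ α w s z ∂gaussianReal 0 1| ≤ |w| + |b| := by
  have hp := stdCDF_pos α
  have hq := stdCDF_lt_one α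
  -- `d` is the error made by using `s` instead of `σ`. The rest, `j` below, has the sign opposite
  -- to `w` by monotonicity and size at most |w| by the Lipschitz bound.
  set d := s * hazard ((σ * α - w) / s) - σ * hazard ((σ * α - w) / σ) with hd
  have hdb := abs_scaled_hazard_sub_le hσ hs (σ * α - w)
  rw [← hd] at hdb
  set j := σ * (hazard ((σ * α - w) / σ) - hazard α) with hj
  have hα : (σ * α - w) / σ - α = -(w / σ) := by field_simp; ring
  have hwσ : σ * (w / σ) = w := by field_simp
  have hjw : w * j ≤ 0 := by
    rcases le_total 0 w with h | h
    · refine mul_nonpos_of_nonneg_of_nonpos h (mul_nonpos_of_nonneg_of_nonpos hσ.le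
        (sub_nonpos.2 (hazard_mono ?_)))
      have := div_nonneg h hσ.le
      linarith
    · refine mul_nonpos_of_nonpos_of_nonneg h (mul_nonneg hσ.le
        (sub_nonneg.2 (hazard_mono ?_)))
      have := div_nonpos_of_nonpos_of_nonneg h hσ.le
      linarith
  have hja : |j| ≤ |w| := by
    rw [hj, abs_mul, abs_of_pos hσ]
    refine (mul_le_mul_of_nonneg_left (abs_hazard_sub_le _ _) hσ.le).trans ?_
    rw [hα, abs_neg, abs_div, abs_of_pos hσ]
    exact (mul_div_cancel₀ _ hσ.ne').le
  have hI : ∫ z, score σ α w s z ∂gaussianReal 0 1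
      = -(stdCDF α * w) + (1 - stdCDF α) * j + (1 - stdCDF α) * d := by
    rw [integral_score]; ring
  have hab : |(1 - stdCDF α) * d| ≤ |d| := by
    rw [abs_mul, abs_of_pos (by linarith)]
    exact mul_le_of_le_one_left (abs_nonneg _) (by linarith)
  refine ⟨(1 - stdCDF α) * d, hab.trans hdb, ?_, ?_⟩
  · rw [hI]
    nlinarith [mul_nonneg (sub_nonneg.2 hq.le) (neg_nonneg.2 hjw)]
  · rw [hI]
    refine (abs_add_le _ _).trans (add_le_add_left ?_ _)
    refine (abs_add_le _ _).trans ?_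
    rw [abs_neg, abs_mul, abs_mul, abs_of_pos hp, abs_of_pos (sub_pos.2 hq)]
    nlinarith [mul_le_mul_of_nonneg_left hja (sub_nonneg.2 hq.le)]

lemma integral_sq_stdGaussian : ∫ z, z ^ 2 ∂gaussianReal 0 1 = 1 := by
  have h := variance_id_gaussianReal (μ := 0) (v := 1)
  rw [variance_of_integral_eq_zero aemeasurable_id (by simp)] at h
  simpa using h

/-- The hazard grows at most linearly, so the second moment grows at most quadratically in `w`. That
suffices, since it enters the recursion with weight of order 1/n². -/
lemma integral_score_sq_le {σ s : ℝ} (hs : 0 < s) (α w : ℝ) :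
    ∫ z, score σ α w s z ^ 2 ∂gaussianReal 0 1
      ≤ 2 * σ ^ 2 + 2 * w ^ 2 + (s * hazard 0 + |σ * α - w|) ^ 2 := by
  have hb : ∀ z, score σ α w s z ^ 2
      ≤ 2 * σ ^ 2 * z ^ 2 + (2 * w ^ 2 + (s * hazard 0 + |σ * α - w|) ^ 2) := by
    intro z
    unfold score
    split_ifs
    · nlinarith [sq_nonneg (σ * z + w), sq_nonneg (s * hazard 0 + |σ * α - w|)]
    · have h1 : s * hazard ((σ * α - w) / s) ≤ s * hazard 0 + |σ * α - w| := by
        refine (mul_le_mul_of_nonneg_left (hazard_le _) hs.le).trans_eq ?_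
        rw [abs_div, abs_of_pos hs]
        field_simp
      have h2 := pow_le_pow_left₀ (mul_nonneg hs.le (hazard_pos _).le) h1 2
      nlinarith [sq_nonneg (σ * z), sq_nonneg w]
  have hi : Integrable (fun z : ℝ => 2 * σ ^ 2 * z ^ 2) (gaussianReal 0 1) :=
    memLp_id_stdGaussian.integrable_sq.const_mul _
  refine (integral_mono (integrable_score_sq σ α w s) (hi.add (integrable_const _)) hb).trans_eq ?_
  rw [integral_add' hi (integrable_const _), integral_const_mul, integral_sq_stdGaussian]
  simp
  ring

end

/-! ### Almost sure convergence of contracting processes -/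

/-- A summability criterion: a convergent nonnegative sequence whose weighted sum is finite, with
weights of infinite total mass, tends to zero. -/
lemma tendsto_zero_of_summable_mul {a y : ℕ → ℝ} (ha : ∀ k, 0 ≤ a k) (hy : ∀ k, 0 ≤ y k)
    (hdiv : ¬ Summable a) (hsum : Summable fun k => a k * y k) {l : ℝ}
    (hl : Tendsto y atTop (𝓝 l)) : Tendsto y atTop (𝓝 0) := by
  have hl0 : 0 ≤ l := ge_of_tendsto' hl hy
  rcases hl0.eq_or_lt with h | h
  · rwa [h]
  · exfalso
    obtain ⟨N, hN⟩ := eventually_atTop.1 (hl.eventually (lt_mem_nhds (half_lt_self h)))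
    apply hdiv
    rw [← summable_nat_add_iff N]
    refine Summable.of_nonneg_of_le (fun k => ha _) (fun k => ?_)
      (((summable_nat_add_iff N).2 hsum).mul_left (2 / l))
    have h1 := hN (k + N) (by omega)
    have h2 := mul_le_mul_of_nonneg_left h1.le (ha (k + N))
    rw [div_mul_eq_mul_div, le_div_iff₀ h]
    linarith

/-- The contraction hypothesis is stated with lower integrals, so that integrability of the process
is a consequence of it; once known, it allows the return to real integrals. -/
lemma setIntegral_le_of_setLIntegral_le {Ω : Type*} [MeasurableSpace Ω] {μ : Measure Ω}
    {f g : Ω → ℝ} {B : Set Ω} (hf : ∀ ω, 0 ≤ f ω) (hg : ∀ ω, 0 ≤ g ω)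
    (hfi : Integrable f μ) (hgi : Integrable g μ)
    (h : ∫⁻ ω in B, ENNReal.ofReal (f ω) ∂μ ≤ ∫⁻ ω in B, ENNReal.ofReal (g ω) ∂μ) :
    ∫ ω in B, f ω ∂μ ≤ ∫ ω in B, g ω ∂μ := by
  rw [← ofReal_integral_eq_lintegral_ofReal hfi.integrableOn (Eventually.of_forall hf),
    ← ofReal_integral_eq_lintegral_ofReal hgi.integrableOn (Eventually.of_forall hg)] at h
  exact (ENNReal.ofReal_le_ofReal_iff (integral_nonneg hg)).1 h

/-- A Robbins–Siegmund type theorem: a nonnegative adapted process contracting in conditional mean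
by factors `1 - a k`, up to summable errors `b k`, tends to zero almost surely. -/
theorem ae_tendsto_zero_of_contraction {Ω : Type*} {m0 : MeasurableSpace Ω} {μ : Measure Ω}
    [IsFiniteMeasure μ] (𝒢 : Filtration ℕ m0) {Y : ℕ → Ω → ℝ} (hadp : StronglyAdapted 𝒢 Y)
    (hY : ∀ k ω, 0 ≤ Y k ω) (hY0 : Integrable (Y 0) μ) {a b : ℕ → ℝ}
    (ha : ∀ k, 0 ≤ a k) (ha1 : ∀ k, a k ≤ 1) (hb : ∀ k, 0 ≤ b k)
    (hdiv : ¬ Summable a) (hsum : Summable b)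
    (hstep : ∀ k (B : Set Ω), MeasurableSet[𝒢 k] B →
      ∫⁻ ω in B, ENNReal.ofReal (Y (k + 1) ω) ∂μ
        ≤ ∫⁻ ω in B, ENNReal.ofReal ((1 - a k) * Y k ω + b k) ∂μ) :
    ∀ᵐ ω ∂μ, Tendsto (fun k => Y k ω) atTop (𝓝 0) := by
  have hint : ∀ k, Integrable (Y k) μ := by
    intro k
    induction k with
    | zero => exact hY0
    | succ k ih =>
      refine ⟨((hadp (k + 1)).mono (𝒢.le _)).aestronglyMeasurable, ?_⟩
      rw [hasFiniteIntegral_iff_ofReal (Eventually.of_forall (hY _))]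
      have h := hstep k Set.univ MeasurableSet.univ
      simp only [Measure.restrict_univ] at h
      refine h.trans_lt ?_
      have hi : Integrable (fun ω => (1 - a k) * Y k ω + b k) μ :=
        (ih.const_mul _).add (integrable_const _)
      exact (hasFiniteIntegral_iff_ofReal (Eventually.of_forall fun ω =>
        add_nonneg (mul_nonneg (sub_nonneg.2 (ha1 k)) (hY k ω)) (hb k))).1 hi.2
  have hrhs : ∀ k, Integrable (fun ω => (1 - a k) * Y k ω + b k) μ := fun k =>
    ((hint k).const_mul _).add (integrable_const _)
  have hstep' : ∀ k (B : Set Ω), MeasurableSet[𝒢 k] B →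
      ∫ ω in B, Y (k + 1) ω ∂μ ≤ ∫ ω in B, ((1 - a k) * Y k ω + b k) ∂μ := fun k B hB =>
    setIntegral_le_of_setLIntegral_le (hY _)
      (fun ω => add_nonneg (mul_nonneg (sub_nonneg.2 (ha1 k)) (hY k ω)) (hb k))
      (hint _) (hrhs k) (hstep k B hB)
  -- the compensated process is a nonnegative supermartingale
  set T := ∑' k, b k with hT
  have hpart : ∀ k, ∑ j ∈ Finset.range k, b j ≤ T := fun k =>
    hsum.sum_le_tsum _ fun j _ => hb j
  -- The sum of a_j Y_j stores the mass lost to contraction, and the last bracket is the nonnegative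
  -- error budget still unspent.
  set Z : ℕ → Ω → ℝ := fun k ω =>
    Y k ω + ∑ j ∈ Finset.range k, a j * Y j ω + (T - ∑ j ∈ Finset.range k, b j) with hZ
  have hZ0 : ∀ k ω, 0 ≤ Z k ω := fun k ω => by
    have := hpart k
    have h2 : 0 ≤ ∑ j ∈ Finset.range k, a j * Y j ω :=
      Finset.sum_nonneg fun j _ => mul_nonneg (ha j) (hY j ω)
    have := hY k ω
    simp only [hZ]; linarith
  have hSi : ∀ k, Integrable (fun ω => ∑ j ∈ Finset.range k, a j * Y j ω) μ := fun k =>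
    integrable_finsetSum _ fun j _ => (hint j).const_mul _
  have hZi : ∀ k, Integrable (Z k) μ := fun k =>
    ((hint k).add (hSi k)).add (integrable_const _)
  have hZadp : StronglyAdapted 𝒢 Z := fun k => by
    refine ((hadp k).add ?_).add stronglyMeasurable_const
    refine Finset.stronglyMeasurable_fun_sum _ fun j hj => ?_
    exact ((hadp j).mono (𝒢.mono (Finset.mem_range.1 hj).le)).const_mul _
  have hsup : Supermartingale Z 𝒢 μ := by
    refine supermartingale_of_setIntegral_succ_le hZadp hZi fun k B hB => ?_
    have hdecomp : ∀ ω, Z k ω = ((1 - a k) * Y k ω + b k)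
        + (∑ j ∈ Finset.range (k + 1), a j * Y j ω + (T - ∑ j ∈ Finset.range (k + 1), b j)) := by
      intro ω
      simp only [hZ, Finset.sum_range_succ]; ring
    have hdecomp' : ∀ ω, Z (k + 1) ω = Y (k + 1) ω
        + (∑ j ∈ Finset.range (k + 1), a j * Y j ω + (T - ∑ j ∈ Finset.range (k + 1), b j)) := by
      intro ω
      simp only [hZ]; ring
    have hr : Integrable (fun ω => ∑ j ∈ Finset.range (k + 1), a j * Y j ω
        + (T - ∑ j ∈ Finset.range (k + 1), b j)) μ := (hSi (k + 1)).add (integrable_const _)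
    simp only [hdecomp, hdecomp']
    rw [integral_add (hint _).integrableOn hr.integrableOn,
      integral_add (hrhs k).integrableOn hr.integrableOn]
    exact add_le_add_left (hstep' k B hB) _
  have hmean : ∀ k, ∫ ω, Z k ω ∂μ ≤ ∫ ω, Z 0 ω ∂μ := fun k => by
    have := hsup.setIntegral_le (Nat.zero_le k) (MeasurableSet.univ (α := Ω))
    simpa using this
  -- As `Z` is nonnegative, its L¹ norm is its mean, so −Z is an L¹-bounded submartingale.
  have hbdd : ∀ k, eLpNorm ((-Z) k) 1 μ ≤ (∫ ω, Z 0 ω ∂μ).toNNReal := fun k => by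
    rw [Pi.neg_apply, eLpNorm_neg, eLpNorm_one_eq_lintegral_enorm]
    have : ∀ ω, ‖Z k ω‖ₑ = ENNReal.ofReal (Z k ω) := fun ω => by
      rw [Real.enorm_eq_ofReal (hZ0 k ω)]
    simp only [this]
    rw [← ofReal_integral_eq_lintegral_ofReal (hZi k) (Eventually.of_forall (hZ0 k))]
    exact ENNReal.ofReal_le_ofReal (hmean k)
  filter_upwards [hsup.neg.ae_tendsto_limitProcess hbdd] with ω hω
  -- convergence of the compensated process bounds the weighted sum
  have hZl := hω.neg
  simp only [Pi.neg_apply, neg_neg] at hZl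
  obtain ⟨C, hC⟩ := hZl.bddAbove_range
  have hS : Summable fun k => a k * Y k ω := by
    refine summable_of_sum_range_le (c := C) (fun k => mul_nonneg (ha k) (hY k ω)) fun k => ?_
    have h1 : Z k ω ≤ C := hC ⟨k, rfl⟩
    have := hpart k
    have := hY k ω
    simp only [hZ] at h1
    linarith
  have hYl : Tendsto (fun k => Y k ω) atTop
      (𝓝 (-(Filtration.limitProcess (-Z) 𝒢 μ ω) - (∑' k, a k * Y k ω) - (T - T))) := by
    refine ((hZl.sub hS.hasSum.tendsto_sum_nat).sub
      (tendsto_const_nhds.sub hsum.hasSum.tendsto_sum_nat)).congr fun k => ?_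
    simp only [hZ]; ring
  exact tendsto_zero_of_summable_mul ha (hY · ω) hdiv hS hYl

/-! ### The ℓ¹ norm and positive definite quadratic forms -/

variable {K : ℕ}

lemma l1Norm_nonneg (v : Fin K → ℝ) : 0 ≤ l1Norm v := Finset.sum_nonneg fun _ _ => abs_nonneg _

lemma abs_apply_le_l1Norm (v : Fin K → ℝ) (i : Fin K) : |v i| ≤ l1Norm v :=
  Finset.single_le_sum (f := fun i => |v i|) (fun _ _ => abs_nonneg _) (Finset.mem_univ i)

lemma l1Norm_eq_zero {v : Fin K → ℝ} (h : l1Norm v = 0) : v = 0 := by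
  funext i
  have := abs_apply_le_l1Norm v i
  rw [h] at this
  simpa using this

lemma l1Norm_smul (c : ℝ) (v : Fin K → ℝ) : l1Norm (c • v) = |c| * l1Norm v := by
  simp [l1Norm, abs_mul, Finset.mul_sum]

lemma continuous_l1Norm : Continuous (l1Norm : (Fin K → ℝ) → ℝ) := by
  unfold l1Norm; fun_prop

lemma abs_dotProduct_le (u v : Fin K → ℝ) : |u ⬝ᵥ v| ≤ l1Norm u * l1Norm v := by
  unfold dotProduct
  refine (Finset.abs_sum_le_sum_abs _ _).trans ?_
  rw [l1Norm, Finset.sum_mul]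
  refine Finset.sum_le_sum fun i _ => ?_
  rw [abs_mul]
  exact mul_le_mul_of_nonneg_left (abs_apply_le_l1Norm v i) (abs_nonneg _)

lemma abs_mulVec_apply_le {A : Matrix (Fin K) (Fin K) ℝ} {r : ℝ} (h : ∀ i j, |A i j| ≤ r)
    (v : Fin K → ℝ) (i : Fin K) : |(A *ᵥ v) i| ≤ r * l1Norm v := by
  unfold Matrix.mulVec dotProduct
  refine (Finset.abs_sum_le_sum_abs _ _).trans ?_
  rw [l1Norm, Finset.mul_sum]
  refine Finset.sum_le_sum fun j _ => ?_
  rw [abs_mul]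
  exact mul_le_mul_of_nonneg_right (h i j) (abs_nonneg _)

lemma l1Norm_mulVec_le {A : Matrix (Fin K) (Fin K) ℝ} {r : ℝ} (h : ∀ i j, |A i j| ≤ r)
    (v : Fin K → ℝ) : l1Norm (A *ᵥ v) ≤ K * r * l1Norm v := by
  calc l1Norm (A *ᵥ v) ≤ ∑ _i : Fin K, r * l1Norm v :=
        Finset.sum_le_sum fun i _ => abs_mulVec_apply_le h v i
    _ = K * r * l1Norm v := by simp; ring

lemma abs_dotProduct_mulVec_le {A : Matrix (Fin K) (Fin K) ℝ} {r : ℝ} (h : ∀ i j, |A i j| ≤ r)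
    (u v : Fin K → ℝ) : |u ⬝ᵥ (A *ᵥ v)| ≤ r * l1Norm u * l1Norm v := by
  unfold dotProduct
  refine (Finset.abs_sum_le_sum_abs _ _).trans ?_
  have : r * l1Norm u * l1Norm v = ∑ i, |u i| * (r * l1Norm v) := by
    rw [← Finset.sum_mul]; unfold l1Norm; ring
  rw [this]
  refine Finset.sum_le_sum fun i _ => ?_
  rw [abs_mul]
  exact mul_le_mul_of_nonneg_left (abs_mulVec_apply_le h v i) (abs_nonneg _)

lemma exists_entry_bound (A : Matrix (Fin K) (Fin K) ℝ) : ∃ q, 0 ≤ q ∧ ∀ i j, |A i j| ≤ q :=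
  ⟨∑ i, ∑ j, |A i j|, Finset.sum_nonneg fun _ _ => Finset.sum_nonneg fun _ _ => abs_nonneg _,
    fun i j => (Finset.single_le_sum (f := fun j => |A i j|) (fun _ _ => abs_nonneg _)
      (Finset.mem_univ j)).trans (Finset.single_le_sum (f := fun i => ∑ j, |A i j|)
      (fun _ _ => Finset.sum_nonneg fun _ _ => abs_nonneg _) (Finset.mem_univ i))⟩

lemma dotProduct_mulVec_pos {Q : Matrix (Fin K) (Fin K) ℝ} (hQ : Q.PosDef) {v : Fin K → ℝ}
    (hv : v ≠ 0) : 0 < v ⬝ᵥ (Q *ᵥ v) := by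
  simpa using hQ.re_dotProduct_pos hv

lemma dotProduct_mulVec_nonneg {Q : Matrix (Fin K) (Fin K) ℝ} (hQ : Q.PosDef) (v : Fin K → ℝ) :
    0 ≤ v ⬝ᵥ (Q *ᵥ v) := by
  by_cases hv : v = 0
  · simp [hv]
  · exact (dotProduct_mulVec_pos hQ hv).le

lemma dotProduct_mulVec_comm {Q : Matrix (Fin K) (Fin K) ℝ} (hQ : Q.PosDef) (u v : Fin K → ℝ) :
    u ⬝ᵥ (Q *ᵥ v) = v ⬝ᵥ (Q *ᵥ u) := by
  have h : Qᵀ = Q := by simpa using hQ.isHermitian.eq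
  rw [Matrix.dotProduct_mulVec, ← Matrix.mulVec_transpose, h, dotProduct_comm]

/-- Positive definite quadratic forms are coercive. -/
lemma exists_coercive {Q : Matrix (Fin K) (Fin K) ℝ} (hQ : Q.PosDef) :
    ∃ l, 0 < l ∧ ∀ v : Fin K → ℝ, l * l1Norm v ^ 2 ≤ v ⬝ᵥ (Q *ᵥ v) := by
  have hcont : Continuous fun v : Fin K → ℝ => v ⬝ᵥ (Q *ᵥ v) := by fun_prop
  have hcomp : IsCompact {v : Fin K → ℝ | l1Norm v = 1} := by
    refine Metric.isCompact_of_isClosed_isBounded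
      (isClosed_eq continuous_l1Norm continuous_const) ?_
    refine (Metric.isBounded_closedBall (x := (0 : Fin K → ℝ)) (r := 1)).subset fun v hv => ?_
    rw [mem_closedBall_zero_iff, pi_norm_le_iff_of_nonneg zero_le_one]
    exact fun i => (abs_apply_le_l1Norm v i).trans_eq hv
  have hscale : ∀ v : Fin K → ℝ, v ≠ 0 → l1Norm ((l1Norm v)⁻¹ • v) = 1 := fun v hv => by
    have h0 : l1Norm v ≠ 0 := fun h => hv (l1Norm_eq_zero h)
    rw [l1Norm_smul, abs_inv, abs_of_nonneg (l1Norm_nonneg v), inv_mul_cancel₀ h0]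
  by_cases hne : {v : Fin K → ℝ | l1Norm v = 1}.Nonempty
  · obtain ⟨u, hu, hmin⟩ := hcomp.exists_isMinOn hne hcont.continuousOn
    have hu0 : u ≠ 0 := by
      rintro rfl
      simp [l1Norm] at hu
    refine ⟨_, dotProduct_mulVec_pos hQ hu0, fun v => ?_⟩
    by_cases hv : v = 0
    · simp [hv, l1Norm]
    have h0 : l1Norm v ≠ 0 := fun h => hv (l1Norm_eq_zero h)
    have h := hmin (hscale v hv)
    simp only [Set.mem_ofPred_eq, Matrix.mulVec_smul, smul_dotProduct, dotProduct_smul,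
      smul_eq_mul] at h
    have h2 : 0 ≤ l1Norm v ^ 2 := sq_nonneg _
    calc _ ≤ ((l1Norm v)⁻¹ * ((l1Norm v)⁻¹ * v ⬝ᵥ (Q *ᵥ v))) * l1Norm v ^ 2 :=
          mul_le_mul_of_nonneg_right h h2
      _ = _ := by field_simp
  -- An empty unit sphere means K = 0; every vector is then zero and any constant works.
  · refine ⟨1, one_pos, fun v => ?_⟩
    have hv : v = 0 := by
      by_contra hv
      exact hne ⟨_, hscale v hv⟩
    simp [hv, l1Norm]

lemma dotProduct_vecMulVec_mulVec (x e : Fin K → ℝ) :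
    e ⬝ᵥ (Matrix.vecMulVec x x *ᵥ e) = (x ⬝ᵥ e) ^ 2 := by
  rw [Matrix.vecMulVec_mulVec]
  simp [dotProduct_comm e x]
  ring

/-! ### The Lyapunov function and its one-step contraction -/

/-- The Lyapunov function `eᵀ Q e + (κ / ν) eᵀ P e`. -/
noncomputable def lyapunov (Q : Matrix (Fin K) (Fin K) ℝ) (κ : ℝ) (P : Matrix (Fin K) (Fin K) ℝ)
    (ν : ℝ) (e : Fin K → ℝ) : ℝ :=
  e ⬝ᵥ (Q *ᵥ e) + κ / ν * e ⬝ᵥ (P *ᵥ e)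

lemma lyapunov_nonneg {Q P : Matrix (Fin K) (Fin K) ℝ} (hQ : Q.PosDef) (hP : P.PosDef) {κ ν : ℝ}
    (hκ : 0 ≤ κ) (hν : 0 ≤ ν) (e : Fin K → ℝ) : 0 ≤ lyapunov Q κ P ν e :=
  add_nonneg (dotProduct_mulVec_nonneg hQ e)
    (mul_nonneg (div_nonneg hκ hν) (dotProduct_mulVec_nonneg hP e))

lemma quadForm_add_smul {Q : Matrix (Fin K) (Fin K) ℝ} (hQ : Q.PosDef) (e u : Fin K → ℝ) (c : ℝ) :
    (e + c • u) ⬝ᵥ (Q *ᵥ (e + c • u))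
      = e ⬝ᵥ (Q *ᵥ e) + 2 * c * e ⬝ᵥ (Q *ᵥ u) + c ^ 2 * u ⬝ᵥ (Q *ᵥ u) := by
  simp only [Matrix.mulVec_add, Matrix.mulVec_smul, add_dotProduct, dotProduct_add,
    smul_dotProduct, dotProduct_smul, smul_eq_mul, dotProduct_mulVec_comm hQ u e]
  ring

lemma posDef_add_vecMulVec {P : Matrix (Fin K) (Fin K) ℝ} (hP : P.PosDef) (σ : ℝ)
    (x : Fin K → ℝ) : (P + (1 / σ ^ 2) • Matrix.vecMulVec x x).PosDef := by
  refine hP.add_posSemidef (Matrix.PosSemidef.smul ?_ (by positivity))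
  simpa using Matrix.posSemidef_vecMulVec_self_star x

/-- One step of the recursion turns the Lyapunov function into a quadratic polynomial of the
innovation `g`. -/
lemma lyapunov_step_eq {Q P : Matrix (Fin K) (Fin K) ℝ} (hQ : Q.PosDef) (hP : P.PosDef)
    {σ : ℝ} (κ ν g : ℝ) (x e : Fin K → ℝ)
    {P' : Matrix (Fin K) (Fin K) ℝ} (hP' : P' = P + (1 / σ ^ 2) • Matrix.vecMulVec x x) :
    lyapunov Q κ P' ν (e + (g / σ ^ 2) • (P'⁻¹ *ᵥ x))
      = (e ⬝ᵥ (Q *ᵥ e) + κ / ν * (e ⬝ᵥ (P *ᵥ e) + (x ⬝ᵥ e) ^ 2 / σ ^ 2))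
        + 2 / σ ^ 2 * (e ⬝ᵥ (Q *ᵥ (P'⁻¹ *ᵥ x)) + κ / ν * (x ⬝ᵥ e)) * g
        + 1 / σ ^ 4 * ((P'⁻¹ *ᵥ x) ⬝ᵥ (Q *ᵥ (P'⁻¹ *ᵥ x)) + κ / ν * x ⬝ᵥ (P'⁻¹ *ᵥ x)) * g ^ 2 := by
  have hP'd : P'.PosDef := hP' ▸ posDef_add_vecMulVec hP σ x
  -- `P'` undoes the gain, so the cross term of the second quadratic form is exactly x·e, without
  -- approximation.
  have hu : P' *ᵥ (P'⁻¹ *ᵥ x) = x := by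
    rw [Matrix.mulVec_mulVec, Matrix.mul_nonsing_inv _ ((Matrix.isUnit_iff_isUnit_det _).1
      hP'd.isUnit), Matrix.one_mulVec]
  have he : e ⬝ᵥ (P' *ᵥ e) = e ⬝ᵥ (P *ᵥ e) + (x ⬝ᵥ e) ^ 2 / σ ^ 2 := by
    rw [hP', Matrix.add_mulVec, Matrix.smul_mulVec, dotProduct_add, dotProduct_smul,
      dotProduct_vecMulVec_mulVec, smul_eq_mul]
    ring
  rw [lyapunov, quadForm_add_smul hQ, quadForm_add_smul hP'd, hu, he, dotProduct_comm e x,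
    dotProduct_comm _ x]
  ring

/-- Scalar core of the contraction. Here `N` is the norm of e, `w` = x·e, `d` the error in (n+1)
eᵀQu ≈ w for the gain u, `b` the bias, `q` and `p` the forms of Q and P at e, and `E₁`, `E₂` the
moments of the innovation. The divisor change gains κlN²/(n+1); `hδl` lets `d` consume at most half
of it, and bias and second moment are of order (1 + N²)/(n+1)². -/
lemma drift_bound {σ κ M δ l D₁ D₂ D₃ n N w d b q p c₂ E₁ E₂ : ℝ} (hσ : 0 < σ) (hκ : 0 < κ)
    (hκ1 : κ ≤ 1) (hM : 0 ≤ M) (hδ : 0 ≤ δ) (hD₁ : 0 ≤ D₁) (hD₂ : 0 ≤ D₂)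
    (hn : 0 < n) (hN : 0 ≤ N) (hw : |w| ≤ M * N) (hd : |d| ≤ δ * N)
    (hb : |b| ≤ D₁ * (1 + N) / (n + 1)) (hp : l * N ^ 2 ≤ p / n)
    (hwE : w * E₁ ≤ -(κ * w ^ 2) + w * b) (hE₁ : |E₁| ≤ |w| + |b|) (hE₂0 : 0 ≤ E₂)
    (hE₂ : E₂ ≤ D₃ * (1 + N ^ 2)) (hc₂ : c₂ ≤ D₂ / (n + 1) ^ 2)
    (hδl : 2 / σ ^ 2 * (δ * M) ≤ κ * l / 2) :
    (q + κ / (n + 1) * (p + w ^ 2 / σ ^ 2))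
        + 2 / σ ^ 2 * ((1 / (n + 1)) * ((1 + κ) * w + d)) * E₁ + c₂ * E₂
      ≤ (q + κ / n * p) - κ * l / 2 * N ^ 2 / (n + 1)
        + (2 / σ ^ 2 * ((2 * M + δ) * (2 * D₁)) + D₂ * D₃) * (1 + N ^ 2) / (n + 1) ^ 2 := by
  have hν : 0 < n + 1 := by linarith
  set ν := n + 1 with hνdef
  have hσ2 : 0 < 2 / σ ^ 2 := by positivity
  -- the innovation part, without the factor `2 / (σ² ν)`
  have hNb : N * |b| ≤ 2 * D₁ * (1 + N ^ 2) / ν := by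
    refine (mul_le_mul_of_nonneg_left hb hN).trans ?_
    rw [← mul_div_assoc]
    refine div_le_div_of_nonneg_right ?_ hν.le
    nlinarith [sq_nonneg (N - 1), mul_nonneg hD₁ (sq_nonneg (N - 1)), mul_nonneg hD₁ (sq_nonneg N)]
  have hwb : w * b ≤ M * (N * |b|) := by
    calc w * b ≤ |w * b| := le_abs_self _
      _ = |w| * |b| := abs_mul _ _
      _ ≤ M * N * |b| := mul_le_mul_of_nonneg_right hw (abs_nonneg _)
      _ = _ := by ring
  have hdE : d * E₁ ≤ δ * M * N ^ 2 + δ * (N * |b|) := by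
    calc d * E₁ ≤ |d * E₁| := le_abs_self _
      _ = |d| * |E₁| := abs_mul _ _
      _ ≤ (δ * N) * (M * N + |b|) := mul_le_mul hd (hE₁.trans (by linarith)) (abs_nonneg _)
          (mul_nonneg hδ hN)
      _ = _ := by ring
  have hNb0 : 0 ≤ N * |b| := mul_nonneg hN (abs_nonneg _)
  have h1 : (1 + κ) * (w * E₁) ≤ -(κ * w ^ 2) + 2 * M * (N * |b|) := by
    have h2 : (1 + κ) * (w * E₁) ≤ (1 + κ) * (-(κ * w ^ 2) + M * (N * |b|)) :=
      mul_le_mul_of_nonneg_left (by linarith) (by linarith)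
    nlinarith [mul_nonneg (mul_nonneg hκ.le hκ.le) (sq_nonneg w),
      mul_nonneg (sub_nonneg.2 hκ1) (mul_nonneg hM hNb0)]
  have h3 : ((1 + κ) * w + d) * E₁
      ≤ -(κ * w ^ 2) + δ * M * N ^ 2 + (2 * M + δ) * (2 * D₁ * (1 + N ^ 2) / ν) := by
    have : (2 * M + δ) * (N * |b|) ≤ (2 * M + δ) * (2 * D₁ * (1 + N ^ 2) / ν) :=
      mul_le_mul_of_nonneg_left hNb (by linarith)
    have e : ((1 + κ) * w + d) * E₁ = (1 + κ) * (w * E₁) + d * E₁ := by ring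
    have e' : (2 * M + δ) * (N * |b|) = 2 * M * (N * |b|) + δ * (N * |b|) := by ring
    rw [e]
    linarith
  have h4 : κ * w ^ 2 / σ ^ 2 + 2 / σ ^ 2 * (((1 + κ) * w + d) * E₁)
      ≤ κ * l / 2 * N ^ 2 + 2 / σ ^ 2 * ((2 * M + δ) * (2 * D₁)) * (1 + N ^ 2) / ν := by
    have h5 := mul_le_mul_of_nonneg_left h3 hσ2.le
    -- The rank-one update of the precision costs only half of what the drift of the innovation
    -- supplies.
    have h6 : κ * w ^ 2 / σ ^ 2 ≤ 2 / σ ^ 2 * (κ * w ^ 2) := by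
      rw [div_mul_eq_mul_div]
      exact div_le_div_of_nonneg_right (by nlinarith [mul_nonneg hκ.le (sq_nonneg w)])
        (sq_nonneg σ)
    have h7 := mul_le_mul_of_nonneg_right hδl (sq_nonneg N)
    have h8 : 2 / σ ^ 2 * ((2 * M + δ) * (2 * D₁ * (1 + N ^ 2) / ν))
        = 2 / σ ^ 2 * ((2 * M + δ) * (2 * D₁)) * (1 + N ^ 2) / ν := by ring
    have e : 2 / σ ^ 2 * (-(κ * w ^ 2) + δ * M * N ^ 2 + (2 * M + δ) * (2 * D₁ * (1 + N ^ 2) / ν))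
        = -(2 / σ ^ 2 * (κ * w ^ 2)) + 2 / σ ^ 2 * (δ * M) * N ^ 2
          + 2 / σ ^ 2 * ((2 * M + δ) * (2 * D₁ * (1 + N ^ 2) / ν)) := by ring
    rw [← h8]
    linarith
  have h9 : c₂ * E₂ ≤ D₂ * D₃ * (1 + N ^ 2) / ν ^ 2 := by
    calc c₂ * E₂ ≤ D₂ / ν ^ 2 * E₂ := mul_le_mul_of_nonneg_right hc₂ hE₂0
      _ ≤ D₂ / ν ^ 2 * (D₃ * (1 + N ^ 2)) := mul_le_mul_of_nonneg_left hE₂ (by positivity)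
      _ = _ := by ring
  -- Source of the decrease in all directions: dividing by n + 1 instead of n.
  have h10 : κ / ν * p = κ / n * p - κ * (p / n) / ν := by
    rw [hνdef]; field_simp; ring
  have h11 : κ * (l * N ^ 2) / ν ≤ κ * (p / n) / ν := by gcongr
  have h12 := div_le_div_of_nonneg_right h4 hν.le
  have e1 : (q + κ / ν * (p + w ^ 2 / σ ^ 2)) + 2 / σ ^ 2 * ((1 / ν) * ((1 + κ) * w + d)) * E₁
      = q + κ / ν * p
        + (κ * w ^ 2 / σ ^ 2 + 2 / σ ^ 2 * (((1 + κ) * w + d) * E₁)) / ν := by ring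
  have e2 : (κ * l / 2 * N ^ 2 + 2 / σ ^ 2 * ((2 * M + δ) * (2 * D₁)) * (1 + N ^ 2) / ν) / ν
      = κ * (l * N ^ 2) / ν - κ * l / 2 * N ^ 2 / ν
        + 2 / σ ^ 2 * ((2 * M + δ) * (2 * D₁)) * (1 + N ^ 2) / ν ^ 2 := by
    field_simp; ring
  have e3 : (2 / σ ^ 2 * ((2 * M + δ) * (2 * D₁)) + D₂ * D₃) * (1 + N ^ 2) / ν ^ 2
      = 2 / σ ^ 2 * ((2 * M + δ) * (2 * D₁)) * (1 + N ^ 2) / ν ^ 2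
        + D₂ * D₃ * (1 + N ^ 2) / ν ^ 2 := by ring
  rw [e1, e3]
  rw [e2] at h12
  linarith

/-- The drift turned into a contraction once `ν` is large. -/
lemma contraction_of_drift {W E k D N Λ ν : ℝ} (hk : 0 < k) (hΛ : 0 < Λ)
    (hν : 0 < ν) (hW : W ≤ Λ * N ^ 2) (hDν : 2 * D / k ≤ ν)
    (h : E ≤ W - k * N ^ 2 / ν + D * (1 + N ^ 2) / ν ^ 2) :
    E ≤ (1 - k / (2 * Λ) / ν) * W + D / ν ^ 2 := by
  -- Half of the decrease absorbs the error quadratic in `N`, since ν ≥ 2D/k; the other half gives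
  -- the rate k/(2Λ) because W ≤ ΛN².
  have h1 : D * N ^ 2 / ν ^ 2 ≤ k / 2 * N ^ 2 / ν := by
    rw [div_le_div_iff₀ (by positivity) hν]
    rw [div_le_iff₀ hk] at hDν
    nlinarith [mul_le_mul_of_nonneg_right hDν (mul_nonneg (sq_nonneg N) hν.le)]
  have h2 : k / (2 * Λ) / ν * W ≤ k / 2 * N ^ 2 / ν := by
    calc k / (2 * Λ) / ν * W ≤ k / (2 * Λ) / ν * (Λ * N ^ 2) :=
          mul_le_mul_of_nonneg_left hW (by positivity)
      _ = _ := by field_simp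
  have e : D * (1 + N ^ 2) / ν ^ 2 = D / ν ^ 2 + D * N ^ 2 / ν ^ 2 := by ring
  have e2 : k * N ^ 2 / ν = k / 2 * N ^ 2 / ν + k / 2 * N ^ 2 / ν := by ring
  rw [e, e2] at h
  linarith

/-- The matrix `P / n` is entrywise within `r` of `Q`, and so are the inverses. -/
def IsClose (Q : Matrix (Fin K) (Fin K) ℝ) (r : ℝ) (n : ℕ) (P : Matrix (Fin K) (Fin K) ℝ) : Prop :=
  ∀ i j, |P i j / n - Q i j| ≤ r ∧ |n * P⁻¹ i j - Q⁻¹ i j| ≤ r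

lemma IsClose.abs_inv_le {Q P : Matrix (Fin K) (Fin K) ℝ} {r q : ℝ} {n : ℕ} (h : IsClose Q r n P)
    (hn : 0 < n) (hr : r ≤ 1) (hq : ∀ i j, |Q⁻¹ i j| ≤ q) (i j : Fin K) :
    |P⁻¹ i j| ≤ (q + 1) / n := by
  have hn' : (0 : ℝ) < n := Nat.cast_pos.2 hn
  rw [le_div_iff₀ hn']
  have h1 : |(n : ℝ) * P⁻¹ i j| ≤ q + 1 := by
    have e : (n : ℝ) * P⁻¹ i j = Q⁻¹ i j + (n * P⁻¹ i j - Q⁻¹ i j) := by ring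
    rw [e]
    exact (abs_add_le _ _).trans (add_le_add (hq i j) ((h i j).2.trans hr))
  rwa [abs_mul, abs_of_pos hn', mul_comm] at h1

lemma IsClose.abs_quadForm_div_sub_le {Q P : Matrix (Fin K) (Fin K) ℝ} {r : ℝ} {n : ℕ}
    (h : IsClose Q r n P) (e : Fin K → ℝ) :
    |e ⬝ᵥ (P *ᵥ e) / n - e ⬝ᵥ (Q *ᵥ e)| ≤ r * l1Norm e ^ 2 := by
  have h1 := abs_dotProduct_mulVec_le (A := (n : ℝ)⁻¹ • P - Q) (r := r) (fun i j => by
    have := (h i j).1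
    rwa [div_eq_inv_mul] at this) e e
  rw [Matrix.sub_mulVec, Matrix.smul_mulVec, dotProduct_sub, dotProduct_smul, smul_eq_mul,
    ← div_eq_inv_mul] at h1
  refine h1.trans_eq ?_
  ring

/-- From s² − σ² = xᵀSx and s + σ ≥ σ. With `S` of order 1/n this makes the hazard bias of order
1/n. -/
lemma predictiveSD_bounds {σ : ℝ} (hσ : 0 < σ) {S : Matrix (Fin K) (Fin K) ℝ} (hS : S.PosDef)
    {x : Fin K → ℝ} {t : ℝ} (ht : x ⬝ᵥ (S *ᵥ x) ≤ t) :
    σ ≤ predictiveSD σ S x ∧ predictiveSD σ S x - σ ≤ t / σ := by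
  have h0 := dotProduct_mulVec_nonneg hS x
  have hsq : predictiveSD σ S x ^ 2 = σ ^ 2 + x ⬝ᵥ (S *ᵥ x) :=
    Real.sq_sqrt (by positivity)
  have h1 : σ ≤ predictiveSD σ S x := Real.le_sqrt_of_sq_le (by linarith)
  refine ⟨h1, ?_⟩
  rw [le_div_iff₀ hσ]
  nlinarith

set_option maxHeartbeats 800000 in
/-- The expected Lyapunov function contracts in one step, at rate `c / (n + 1)`, with constants
depending only on the bounds for the design and for the log censoring time. -/
theorem exists_contraction {σ : ℝ} (hσ : 0 < σ) {Q : Matrix (Fin K) (Fin K) ℝ} (hQ : Q.PosDef)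
    {M B : ℝ} (hM : 0 ≤ M) (hB : 0 ≤ B) :
    ∃ κ c D r : ℝ, ∃ N₀ : ℕ, 0 < κ ∧ 0 < c ∧ 0 ≤ D ∧ 0 < r ∧ c ≤ 1 ∧
      ∀ n, N₀ ≤ n → ∀ (P P' : Matrix (Fin K) (Fin K) ℝ) (x e : Fin K → ℝ) (a : ℝ),
        P.PosDef → P' = P + (1 / σ ^ 2) • Matrix.vecMulVec x x → l1Norm x ≤ M → |a| ≤ B →
        IsClose Q r n P → IsClose Q r (n + 1) P' →
        ∫ z, lyapunov Q κ P' (n + 1 : ℕ) (e + (score σ (a / σ) (x ⬝ᵥ e) (predictiveSD σ P⁻¹ x) z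
            / σ ^ 2) • (P'⁻¹ *ᵥ x)) ∂gaussianReal 0 1
          ≤ (1 - c / (n + 1 : ℕ)) * lyapunov Q κ P n e + D / ((n + 1 : ℕ) : ℝ) ^ 2 := by
  obtain ⟨l₀, hl₀, hcoer⟩ := exists_coercive hQ
  obtain ⟨q, hq0, hq⟩ := exists_entry_bound Q
  obtain ⟨q', hq'0, hq'⟩ := exists_entry_bound Q⁻¹
  -- Lower bound for the conditional probability of an observed failure, as a ≥ −B.
  set κ := stdCDF (-B / σ) with hκdef
  have hκ : 0 < κ := stdCDF_pos _
  have hκ1 : κ ≤ 1 := (stdCDF_lt_one _).le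
  have hh0 : 0 < hazard 0 := hazard_pos 0
  set l := l₀ / 2 with hl
  have hl0 : 0 < l := by positivity
  -- The cap 1 bounds the entries of nP⁻¹, the cap l = l₀/2 keeps P/n coercive, and the last one
  -- makes the gain error at most half of the decrease; its `+ 1` keeps the denominator positive.
  set r := min (min 1 l) ((κ * l / 2) / (2 / σ ^ 2 * (q * K * M * M) + 1)) with hr
  have hr0 : 0 < r := by positivity
  have hr1 : r ≤ 1 := (min_le_left _ _).trans (min_le_left _ _)
  have hrl : r ≤ l := (min_le_left _ _).trans (min_le_right _ _)
  set δ := q * K * M * r with hδ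
  have hδ0 : 0 ≤ δ := by positivity
  have hδl : 2 / σ ^ 2 * (δ * M) ≤ κ * l / 2 := by
    have h1 : r ≤ (κ * l / 2) / (2 / σ ^ 2 * (q * K * M * M) + 1) := min_le_right _ _
    rw [le_div_iff₀ (by positivity)] at h1
    have : 2 / σ ^ 2 * (δ * M) = r * (2 / σ ^ 2 * (q * K * M * M)) := by rw [hδ]; ring
    rw [this]
    linarith
  -- Chosen so that s − σ ≤ t/(n+1); the factor 2 comes from 1/n ≤ 2/(n+1).
  set t := (q' + 1) * M * M * 2 / σ with ht
  have ht0 : 0 ≤ t := by positivity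
  set D₁ := t * (hazard 0 + 2 * (B + M) / σ) with hD₁
  have hD₁0 : 0 ≤ D₁ := by positivity
  set U := K * (q' + 1) * M with hU
  have hU0 : 0 ≤ U := by positivity
  set D₂ := 1 / σ ^ 4 * (q * U * U + κ * M * U) with hD₂
  have hD₂0 : 0 ≤ D₂ := by positivity
  set D₃ := 2 * σ ^ 2 + 2 * M ^ 2 + 2 * ((σ + t) * hazard 0 + B + M) ^ 2 with hD₃
  have hD₃0 : 0 ≤ D₃ := by positivity
  set D := 2 / σ ^ 2 * ((2 * M + δ) * (2 * D₁)) + D₂ * D₃ with hD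
  have hD0 : 0 ≤ D := by positivity
  set k := κ * l / 2 with hk
  have hk0 : 0 < k := by positivity
  -- The summand `k` keeps Λ positive and forces the rate k/(2Λ) below 1.
  set Λ := q + κ * (q + 1) + k with hΛ
  have hΛ0 : 0 < Λ := by positivity
  obtain ⟨N₁, hN₁⟩ := exists_nat_ge (2 * D / k)
  clear_value κ D D₁ D₂ D₃ Λ k U t δ r l
  refine ⟨κ, k / (2 * Λ), D, r, N₁ + 1, hκ, by positivity, hD0, hr0, ?_, ?_⟩
  · rw [div_le_one (by positivity)]
    have : 0 ≤ κ * (q + 1) := by positivity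
    linarith
  intro n hn P P' x e a hP hP' hx ha hclose hclose'
  have hn0 : 0 < n := by omega
  have hnR : (0 : ℝ) < n := Nat.cast_pos.2 hn0
  have hn1 : (1 : ℝ) ≤ n := Nat.one_le_cast.2 hn0
  have hP'd : P'.PosDef := hP' ▸ posDef_add_vecMulVec hP σ x
  set N := l1Norm e with hN
  have hN0 : 0 ≤ N := l1Norm_nonneg e
  have hx0 : 0 ≤ l1Norm x := l1Norm_nonneg x
  set w := x ⬝ᵥ e with hw
  have hwb : |w| ≤ M * N := (abs_dotProduct_le x e).trans (mul_le_mul_of_nonneg_right hx hN0)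
  have hν : (0 : ℝ) < n + 1 := by linarith
  have h1n : 1 / (n : ℝ) ≤ 2 / (n + 1) := by
    rw [div_le_div_iff₀ hnR hν]; linarith
  -- the predictive standard deviation
  set s := predictiveSD σ P⁻¹ x with hs
  have hxSx : x ⬝ᵥ (P⁻¹ *ᵥ x) ≤ (q' + 1) * M * M * 2 / (n + 1) := by
    calc x ⬝ᵥ (P⁻¹ *ᵥ x) ≤ |x ⬝ᵥ (P⁻¹ *ᵥ x)| := le_abs_self _
      _ ≤ (q' + 1) / n * l1Norm x * l1Norm x :=
        abs_dotProduct_mulVec_le (hclose.abs_inv_le hn0 hr1 hq') x x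
      _ ≤ (q' + 1) / n * M * M := by gcongr
      _ = (q' + 1) * M * M * (1 / n) := by ring
      _ ≤ (q' + 1) * M * M * (2 / (n + 1)) := by gcongr
      _ = _ := by ring
  obtain ⟨hσs, hsσ⟩ := predictiveSD_bounds hσ hP.inv hxSx
  rw [← hs] at hσs hsσ
  have hsσ' : s - σ ≤ t / (n + 1) := hsσ.trans_eq (by rw [ht]; ring)
  have hsσt : s ≤ σ + t := by
    have : t / (n + 1) ≤ t := div_le_self ht0 (by linarith)
    linarith
  have hs0 : 0 < s := hσ.trans_le hσs
  have hσa : σ * (a / σ) = a := mul_div_cancel₀ _ hσ.ne'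
  have haw : |a - w| ≤ B + M * N :=
    (abs_sub _ _).trans (add_le_add ha hwb)
  -- the mean of the score
  obtain ⟨b, hb, hwE, hE₁⟩ := exists_integral_score_eq hσ hσs (a / σ) w
  rw [hσa] at hb
  have hb' : |b| ≤ D₁ * (1 + N) / (n + 1) := by
    refine hb.trans ?_
    have h1 : hazard 0 + 2 * |a - w| / σ ≤ (hazard 0 + 2 * (B + M) / σ) * (1 + N) := by
      calc hazard 0 + 2 * |a - w| / σ ≤ hazard 0 + 2 * (B + M * N) / σ := by gcongr
        _ ≤ hazard 0 + 2 * (B + M * N) / σ + (hazard 0 * N + 2 * (B * N + M) / σ) := by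
          have : 0 ≤ hazard 0 * N + 2 * (B * N + M) / σ := by positivity
          linarith
        _ = _ := by ring
    calc (s - σ) * (hazard 0 + 2 * |a - w| / σ)
        ≤ (t / (n + 1)) * ((hazard 0 + 2 * (B + M) / σ) * (1 + N)) :=
          mul_le_mul hsσ' h1 (by positivity) (by positivity)
      _ = _ := by rw [hD₁]; ring
  have hwE' : w * (∫ z, score σ (a / σ) w s z ∂gaussianReal 0 1) ≤ -(κ * w ^ 2) + w * b := by
    have h1 : κ ≤ stdCDF (a / σ) := hκdef ▸ stdCDF_mono (by
      have := (abs_le.1 ha).1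
      gcongr)
    have := mul_le_mul_of_nonneg_right h1 (sq_nonneg w)
    linarith
  -- the second moment of the score
  have hE₂ : ∫ z, score σ (a / σ) w s z ^ 2 ∂gaussianReal 0 1 ≤ D₃ * (1 + N ^ 2) := by
    refine (integral_score_sq_le hs0 (a / σ) w).trans ?_
    rw [hσa]
    have h1 : s * hazard 0 + |a - w| ≤ ((σ + t) * hazard 0 + B + M) * (1 + N) := by
      have h2 : s * hazard 0 ≤ (σ + t) * hazard 0 := mul_le_mul_of_nonneg_right hsσt hh0.le
      have h3 : 0 ≤ ((σ + t) * hazard 0 + B) * N + M := by positivity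
      linarith
    have h2 : (s * hazard 0 + |a - w|) ^ 2 ≤ (((σ + t) * hazard 0 + B + M) * (1 + N)) ^ 2 :=
      pow_le_pow_left₀ (by positivity) h1 2
    have h3 : (1 + N) ^ 2 ≤ 2 * (1 + N ^ 2) := by linarith [sq_nonneg (N - 1)]
    have h4 := mul_le_mul_of_nonneg_left h3 (sq_nonneg ((σ + t) * hazard 0 + B + M))
    have h5 : w ^ 2 ≤ M ^ 2 * N ^ 2 := by
      rw [← mul_pow, ← sq_abs w]
      exact pow_le_pow_left₀ (abs_nonneg w) hwb 2
    have h6 : 0 ≤ 2 * σ ^ 2 * N ^ 2 := by positivity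
    have h7 : 0 ≤ 2 * M ^ 2 := by positivity
    rw [mul_pow] at h2
    rw [hD₃]
    linarith
  have hE₂0 : 0 ≤ ∫ z, score σ (a / σ) w s z ^ 2 ∂gaussianReal 0 1 :=
    integral_nonneg fun _ => sq_nonneg _
  -- the gain vector
  set u := P'⁻¹ *ᵥ x with hu
  have huN : l1Norm u ≤ U / (n + 1) := by
    have h1 := l1Norm_mulVec_le (hclose'.abs_inv_le (Nat.succ_pos n) hr1 hq') x
    push_cast at h1
    calc l1Norm u ≤ K * ((q' + 1) / (n + 1)) * l1Norm x := h1
      _ ≤ K * ((q' + 1) / (n + 1)) * M := by gcongr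
      _ = _ := by rw [hU]; ring
  have hc₂ : 1 / σ ^ 4 * (u ⬝ᵥ (Q *ᵥ u) + κ / (n + 1) * x ⬝ᵥ u) ≤ D₂ / (n + 1) ^ 2 := by
    have hu0 := l1Norm_nonneg u
    have h1 : u ⬝ᵥ (Q *ᵥ u) ≤ q * (U / (n + 1)) * (U / (n + 1)) := by
      refine (le_abs_self _).trans ((abs_dotProduct_mulVec_le hq u u).trans ?_)
      gcongr
    have h2 : x ⬝ᵥ u ≤ M * (U / (n + 1)) := by
      refine (le_abs_self _).trans ((abs_dotProduct_le x u).trans ?_)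
      gcongr
    calc 1 / σ ^ 4 * (u ⬝ᵥ (Q *ᵥ u) + κ / (n + 1) * x ⬝ᵥ u)
        ≤ 1 / σ ^ 4 * (q * (U / (n + 1)) * (U / (n + 1)) + κ / (n + 1) * (M * (U / (n + 1)))) := by
          gcongr
      _ = _ := by rw [hD₂]; field_simp
  have hd : |(n + 1) * e ⬝ᵥ (Q *ᵥ u) - w| ≤ δ * N := by
    set R : Matrix (Fin K) (Fin K) ℝ := ((n : ℝ) + 1) • P'⁻¹ - Q⁻¹ with hR
    have hRb : ∀ i j, |R i j| ≤ r := fun i j => by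
      have := (hclose' i j).2
      push_cast at this
      exact this
    -- Since QQ⁻¹ = 1, the deviation of (n+1) eᵀQu from x·e involves only the small matrix `R`.
    have e1 : (n + 1) * e ⬝ᵥ (Q *ᵥ u) - w = e ⬝ᵥ (Q *ᵥ (R *ᵥ x)) := by
      rw [hR, Matrix.sub_mulVec, Matrix.smul_mulVec, Matrix.mulVec_sub, Matrix.mulVec_smul,
        dotProduct_sub, dotProduct_smul, smul_eq_mul, Matrix.mulVec_mulVec _ Q Q⁻¹,
        Matrix.mul_nonsing_inv _ ((Matrix.isUnit_iff_isUnit_det _).1 hQ.isUnit),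
        Matrix.one_mulVec, dotProduct_comm e x]
    rw [e1]
    calc |e ⬝ᵥ (Q *ᵥ (R *ᵥ x))| ≤ q * N * l1Norm (R *ᵥ x) := abs_dotProduct_mulVec_le hq e _
      _ ≤ q * N * (K * r * l1Norm x) := by
        gcongr
        exact l1Norm_mulVec_le hRb x
      _ ≤ q * N * (K * r * M) := by gcongr
      _ = _ := by rw [hδ]; ring
  -- the quadratic forms
  have hPe := abs_le.1 (hclose.abs_quadForm_div_sub_le e)
  have hrN := mul_le_mul_of_nonneg_right hrl (sq_nonneg N)
  have hr1N := mul_le_mul_of_nonneg_right hr1 (sq_nonneg N)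
  have hQe := hcoer e
  have hp : l * N ^ 2 ≤ e ⬝ᵥ (P *ᵥ e) / n := by
    have : l₀ * N ^ 2 = l * N ^ 2 + l * N ^ 2 := by rw [hl]; ring
    linarith [hPe.1]
  have hQe' : e ⬝ᵥ (Q *ᵥ e) ≤ q * N ^ 2 :=
    (le_abs_self _).trans ((abs_dotProduct_mulVec_le hq e e).trans_eq (by ring))
  have hW : lyapunov Q κ P n e ≤ Λ * N ^ 2 := by
    have h1 : e ⬝ᵥ (P *ᵥ e) / n ≤ (q + 1) * N ^ 2 := by linarith [hPe.2]
    have h2 : κ / n * e ⬝ᵥ (P *ᵥ e) ≤ κ * ((q + 1) * N ^ 2) := by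
      rw [div_mul_eq_mul_div, mul_div_assoc]
      exact mul_le_mul_of_nonneg_left h1 hκ.le
    have h3 : 0 ≤ k * N ^ 2 := by positivity
    rw [lyapunov, hΛ]
    linarith
  -- assemble
  have hstep := drift_bound (q := e ⬝ᵥ (Q *ᵥ e)) hσ hκ hκ1 hM hδ0 hD₁0 hD₂0 hnR hN0 hwb hd hb' hp
    hwE' hE₁ hE₂0 hE₂ hc₂ (hk ▸ hδl)
  rw [← hk, ← hD] at hstep
  -- The coefficient eᵀQu + κw/(n+1) is rewritten as ((1 + κ)w + d)/(n+1) to match `drift_bound`.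
  have hI : ∫ z, lyapunov Q κ P' (n + 1 : ℕ) (e + (score σ (a / σ) w s z / σ ^ 2) • u)
        ∂gaussianReal 0 1
      = (e ⬝ᵥ (Q *ᵥ e) + κ / (n + 1) * (e ⬝ᵥ (P *ᵥ e) + w ^ 2 / σ ^ 2))
        + 2 / σ ^ 2 * ((1 / (n + 1)) * ((1 + κ) * w + ((n + 1) * e ⬝ᵥ (Q *ᵥ u) - w)))
          * (∫ z, score σ (a / σ) w s z ∂gaussianReal 0 1)
        + 1 / σ ^ 4 * (u ⬝ᵥ (Q *ᵥ u) + κ / (n + 1) * x ⬝ᵥ u)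
          * ∫ z, score σ (a / σ) w s z ^ 2 ∂gaussianReal 0 1 := by
    have hi1 : Integrable (fun z => (e ⬝ᵥ (Q *ᵥ e) + κ / (n + 1) * (e ⬝ᵥ (P *ᵥ e) + w ^ 2 / σ ^ 2))
        + 2 / σ ^ 2 * (e ⬝ᵥ (Q *ᵥ u) + κ / (n + 1) * w) * score σ (a / σ) w s z)
        (gaussianReal 0 1) :=
      (integrable_const _).add ((integrable_score _ _ _ _).const_mul _)
    simp only [hu, hw, lyapunov_step_eq hQ hP _ _ _ _ _ hP']
    simp only [← hu, ← hw]
    push_cast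
    rw [integral_add hi1 ((integrable_score_sq _ _ _ _).const_mul _),
      integral_add (integrable_const _) ((integrable_score _ _ _ _).const_mul _),
      integral_const_mul, integral_const_mul]
    simp only [integral_const, probReal_univ, one_smul]
    congr 3
    field_simp
    ring
  rw [hI]
  have hNn : ((N₁ : ℝ)) ≤ n := by exact_mod_cast (by omega : N₁ ≤ n)
  have := contraction_of_drift hk0 hΛ0 hν hW (by linarith : 2 * D / k ≤ (n : ℝ) + 1) hstep
  push_cast
  exact this

/-! ### Error recursion and limits of the precision matrices -/

/-- One step of the recursion for the estimation error `e = θ - β`, where `P`, `P'` are the current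
and the next precision matrix, `a` is the log censoring time minus the mean log lifetime, and `z`
is the standardized error. -/
noncomputable def errorStep (σ : ℝ) (P P' : Matrix (Fin K) (Fin K) ℝ) (x e : Fin K → ℝ)
    (a z : ℝ) : Fin K → ℝ :=
  e + (score σ (a / σ) (x ⬝ᵥ e) (predictiveSD σ P⁻¹ x) z / σ ^ 2) • (P'⁻¹ *ᵥ x)

/-- Taking logarithms turns T ≤ τ into ε/σ ≤ (log τ − xᵀβ)/σ. Both branches of the update then
become the score at w = xᵀ(θ − β), the censored one because φ(η)/(1 − Φ(η)) is the hazard. -/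
lemma posteriorMean_succ_sub {σ : ℝ} (hσ : 0 < σ) (β θ₀ : Fin K → ℝ)
    (S₀ : Matrix (Fin K) (Fin K) ℝ) (x : ℕ → Fin K → ℝ) {τ : ℕ → ℝ} (hτ : ∀ n, 0 < τ n)
    (ε : ℕ → ℝ) (n : ℕ) :
    posteriorMean σ θ₀ S₀ x τ (fun k => lifetime β (x k) (ε k)) (n + 1) - β
      = errorStep σ (precision σ S₀ x n) (precision σ S₀ x (n + 1)) (x (n + 1))
          (posteriorMean σ θ₀ S₀ x τ (fun k => lifetime β (x k) (ε k)) n - β)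
          (Real.log (τ (n + 1)) - x (n + 1) ⬝ᵥ β) (ε (n + 1) / σ) := by
  have hiff : ε (n + 1) / σ ≤ (Real.log (τ (n + 1)) - x (n + 1) ⬝ᵥ β) / σ ↔
      lifetime β (x (n + 1)) (ε (n + 1)) ≤ τ (n + 1) := by
    rw [div_le_div_iff_of_pos_right hσ, lifetime, ← Real.le_log_iff_exp_le (hτ _), le_sub_iff_add_le']
  have hσ1 : σ * (ε (n + 1) / σ) = ε (n + 1) := mul_div_cancel₀ _ hσ.ne'
  have hσ2 : σ * ((Real.log (τ (n + 1)) - x (n + 1) ⬝ᵥ β) / σ)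
      = Real.log (τ (n + 1)) - x (n + 1) ⬝ᵥ β := mul_div_cancel₀ _ hσ.ne'
  set θ := posteriorMean σ θ₀ S₀ x τ (fun k => lifetime β (x k) (ε k)) n with hθ
  have hlog : Real.log (lifetime β (x (n + 1)) (ε (n + 1))) = x (n + 1) ⬝ᵥ β + ε (n + 1) :=
    Real.log_exp _
  rw [posteriorMean, errorStep, score, ← hθ, hσ1, hσ2, dotProduct_sub]
  simp only [hlog, failureIndicator, covMatrix]
  by_cases h : lifetime β (x (n + 1)) (ε (n + 1)) ≤ τ (n + 1)
  · rw [if_pos h, if_pos (hiff.2 h)]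
    simp only [sub_self, zero_mul, zero_smul, add_zero, one_mul]
    have : x (n + 1) ⬝ᵥ β + ε (n + 1) - x (n + 1) ⬝ᵥ θ
        = ε (n + 1) - (x (n + 1) ⬝ᵥ θ - x (n + 1) ⬝ᵥ β) := by ring
    rw [this]
    abel
  · rw [if_neg h, if_neg (fun h' => h (hiff.1 h'))]
    have h1 : Real.log (τ (n + 1)) - x (n + 1) ⬝ᵥ β - (x (n + 1) ⬝ᵥ θ - x (n + 1) ⬝ᵥ β)
        = Real.log (τ (n + 1)) - x (n + 1) ⬝ᵥ θ := by ring
    have h2 : ∀ η s : ℝ, stdPDF η * s / ((1 - stdCDF η) * σ ^ 2) = s * hazard η / σ ^ 2 := by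
      intro η s
      rw [hazard, ← mul_div_assoc, div_div, mul_comm s]
    rw [h1]
    simp only [zero_mul, zero_smul, add_zero, sub_zero, one_mul, h2, stdThreshold]
    abel

lemma precision_posDef {σ : ℝ} {S₀ : Matrix (Fin K) (Fin K) ℝ} (hS₀ : S₀.PosDef)
    (x : ℕ → Fin K → ℝ) (n : ℕ) : (precision σ S₀ x n).PosDef := by
  induction n with
  | zero => exact hS₀.inv
  | succ n ih => exact posDef_add_vecMulVec ih σ _

lemma precision_apply (σ : ℝ) (S₀ : Matrix (Fin K) (Fin K) ℝ) (x : ℕ → Fin K → ℝ) (n : ℕ)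
    (i j : Fin K) : precision σ S₀ x n i j
      = S₀⁻¹ i j + 1 / σ ^ 2 * ∑ k ∈ Finset.range n, x (k + 1) i * x (k + 1) j := by
  induction n with
  | zero => simp [precision]
  | succ n ih =>
    rw [precision, Matrix.add_apply, ih, Finset.sum_range_succ, Matrix.smul_apply,
      Matrix.vecMulVec_apply, smul_eq_mul]
    ring

/-- Entrywise convergence of `P n / n` to an invertible limit carries over to the inverses. -/
lemma eventually_isClose {P : ℕ → Matrix (Fin K) (Fin K) ℝ} {Q : Matrix (Fin K) (Fin K) ℝ}
    (hQ : Q.PosDef) (h : ∀ i j, Tendsto (fun n => P n i j / n) atTop (𝓝 (Q i j))) {r : ℝ}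
    (hr : 0 < r) : ∀ᶠ n in atTop, IsClose Q r n (P n) := by
  have hdet : Q.det ≠ 0 := hQ.det_pos.ne'
  have hT : Tendsto (fun n : ℕ => (n : ℝ)⁻¹ • P n) atTop (𝓝 Q) := by
    refine tendsto_pi_nhds.2 fun i => tendsto_pi_nhds.2 fun j => ?_
    refine (h i j).congr fun n => ?_
    rw [Matrix.smul_apply, smul_eq_mul, div_eq_inv_mul]
  have hcont : ContinuousAt Inv.inv Q := continuousAt_matrix_inv Q (by
    rw [Ring.inverse_eq_inv']
    exact continuousAt_inv₀ hdet)
  have hI := hcont.tendsto.comp hT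
  have hentry : ∀ i j, Tendsto (fun n : ℕ => ((n : ℝ)⁻¹ • P n)⁻¹ i j) atTop (𝓝 (Q⁻¹ i j)) :=
    fun i j => tendsto_pi_nhds.1 (tendsto_pi_nhds.1 hI i) j
  have hclose : ∀ {u : ℕ → ℝ} {l : ℝ}, Tendsto u atTop (𝓝 l) → ∀ᶠ n in atTop, |u n - l| ≤ r := by
    intro u l hu
    filter_upwards [Metric.tendsto_nhds.1 hu r hr] with n hn
    exact (Real.dist_eq _ _ ▸ hn).le
  simp only [IsClose, eventually_all]
  refine fun i j => (hclose (h i j)).and ?_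
  filter_upwards [hclose (hentry i j), eventually_gt_atTop 0,
    hT.eventually ((continuous_id.matrix_det.continuousAt (x := Q)).eventually_ne hdet)]
    with n hn hn0 hdn
  have hn' : (n : ℝ) ≠ 0 := Nat.cast_ne_zero.2 hn0.ne'
  have : ((n : ℝ)⁻¹ • P n)⁻¹ = (n : ℝ) • (P n)⁻¹ := by
    refine Matrix.inv_eq_left_inv ?_
    have hu : IsUnit (P n).det := by
      refine isUnit_iff_ne_zero.2 fun h0 => hdn ?_
      simp [h0]
    rw [Matrix.smul_mul, Matrix.mul_smul, smul_smul, mul_inv_cancel₀ hn', one_smul,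
      Matrix.nonsing_inv_mul _ hu]
  rwa [this, Matrix.smul_apply, smul_eq_mul] at hn

/-! ### Measurability of the recursion -/

section Measurability

variable {α : Type*} [MeasurableSpace α]

lemma measurable_hazard : Measurable hazard :=
  continuous_stdPDF.measurable.div (stdCDF_mono.measurable.const_sub 1)

lemma measurable_score {σ : ℝ} {a w s z : α → ℝ} (ha : Measurable a) (hw : Measurable w)
    (hs : Measurable s) (hz : Measurable z) :
    Measurable fun ω => score σ (a ω) (w ω) (s ω) (z ω) := by
  unfold score
  exact Measurable.ite (measurableSet_le hz ha) ((hz.const_mul σ).sub hw)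
    (hs.mul (measurable_hazard.comp (((ha.const_mul σ).sub hw).div hs)))

lemma measurable_dotProduct {u v : α → Fin K → ℝ} (hu : Measurable u) (hv : Measurable v) :
    Measurable fun ω => u ω ⬝ᵥ v ω :=
  Finset.measurable_fun_sum _ fun i _ => ((measurable_pi_apply i).comp hu).mul
    ((measurable_pi_apply i).comp hv)

lemma measurable_mulVec {A : α → Matrix (Fin K) (Fin K) ℝ} {v : α → Fin K → ℝ}
    (hA : ∀ i j, Measurable fun ω => A ω i j) (hv : Measurable v) :
    Measurable fun ω => A ω *ᵥ v ω :=
  measurable_pi_iff.2 fun i => measurable_dotProduct (measurable_pi_iff.2 (hA i)) hv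

lemma measurable_det {A : α → Matrix (Fin K) (Fin K) ℝ}
    (hA : ∀ i j, Measurable fun ω => A ω i j) : Measurable fun ω => (A ω).det := by
  simp only [Matrix.det_apply']
  exact Finset.measurable_fun_sum _ fun p _ =>
    (Finset.measurable_fun_prod _ fun i _ => hA _ _).const_mul _

/-- By Cramer's rule an entry is a cofactor divided by the determinant; this covers singular
matrices too, where inversion need not be continuous. -/
lemma measurable_inv_apply {A : α → Matrix (Fin K) (Fin K) ℝ}
    (hA : ∀ i j, Measurable fun ω => A ω i j) (i j : Fin K) :
    Measurable fun ω => (A ω)⁻¹ i j := by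
  simp only [Matrix.inv_def, Matrix.smul_apply, smul_eq_mul, Matrix.adjugate_apply,
    Ring.inverse_eq_inv']
  refine (measurable_det hA).inv.mul (measurable_det fun k l => ?_)
  simp only [Matrix.updateRow_apply]
  by_cases hk : k = j
  · simp [hk]
  · simpa [hk] using hA k l

lemma measurable_errorStep {σ : ℝ} {P P' : α → Matrix (Fin K) (Fin K) ℝ} {x e : α → Fin K → ℝ}
    {a z : α → ℝ} (hP : ∀ i j, Measurable fun ω => P ω i j)
    (hP' : ∀ i j, Measurable fun ω => P' ω i j) (hx : Measurable x) (he : Measurable e)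
    (ha : Measurable a) (hz : Measurable z) :
    Measurable fun ω => errorStep σ (P ω) (P' ω) (x ω) (e ω) (a ω) (z ω) := by
  have hs : Measurable fun ω => predictiveSD σ (P ω)⁻¹ (x ω) :=
    ((measurable_dotProduct hx (measurable_mulVec (measurable_inv_apply hP) hx)).const_add _).sqrt
  have hg := measurable_mulVec (measurable_inv_apply hP') hx
  have hc := (measurable_score (σ := σ) (ha.div_const σ) (measurable_dotProduct hx he) hs
    hz).div_const (σ ^ 2)
  exact he.add (hc.smul hg)

lemma measurable_lyapunov {Q : Matrix (Fin K) (Fin K) ℝ} {κ ν : ℝ}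
    {P : α → Matrix (Fin K) (Fin K) ℝ} {e : α → Fin K → ℝ}
    (hP : ∀ i j, Measurable fun ω => P ω i j) (he : Measurable e) :
    Measurable fun ω => lyapunov Q κ (P ω) ν (e ω) := by
  have h1 : Measurable fun ω => Q *ᵥ e ω :=
    measurable_mulVec (A := fun _ => Q) (fun _ _ => measurable_const) he
  have h2 : Measurable fun ω => P ω *ᵥ e ω := measurable_mulVec hP he
  exact (measurable_dotProduct he h1).add ((measurable_dotProduct he h2).const_mul _)

lemma measurable_precision_apply {σ : ℝ} {S₀ : Matrix (Fin K) (Fin K) ℝ}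
    {x : ℕ → α → Fin K → ℝ} {n : ℕ} (hx : ∀ k ∈ Set.Icc 1 n, Measurable (x k)) (i j : Fin K) :
    Measurable fun ω => precision σ S₀ (fun k => x k ω) n i j := by
  simp only [precision_apply]
  refine ((Finset.measurable_fun_sum _ fun k hk => ?_).const_mul _).const_add _
  have := hx (k + 1) ⟨by omega, by have := Finset.mem_range.1 hk; omega⟩
  exact ((measurable_pi_apply i).comp this).mul ((measurable_pi_apply j).comp this)

lemma measurable_posteriorMean_sub {σ : ℝ} (hσ : 0 < σ) (β θ₀ : Fin K → ℝ)
    (S₀ : Matrix (Fin K) (Fin K) ℝ) {x : ℕ → α → Fin K → ℝ} {τ ε : ℕ → α → ℝ}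
    (hτ_pos : ∀ n ω, 0 < τ n ω) {n : ℕ} (hx : ∀ k ∈ Set.Icc 1 n, Measurable (x k))
    (hτ : ∀ k ∈ Set.Icc 1 n, Measurable (τ k)) (hε : ∀ k ∈ Set.Icc 1 n, Measurable (ε k)) :
    Measurable fun ω => posteriorMean σ θ₀ S₀ (fun k => x k ω) (fun k => τ k ω)
      (fun k => lifetime β (x k ω) (ε k ω)) n - β := by
  induction n with
  | zero => simpa only [posteriorMean] using measurable_const
  | succ n ih =>
    have hsub : ∀ k ∈ Set.Icc 1 n, k ∈ Set.Icc 1 (n + 1) := fun k hk => ⟨hk.1, hk.2.trans n.le_succ⟩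
    have hmem : n + 1 ∈ Set.Icc 1 (n + 1) := ⟨by omega, le_rfl⟩
    simp only [fun ω => posteriorMean_succ_sub hσ β θ₀ S₀ (fun k => x k ω) (fun k => hτ_pos k ω)
      (fun k => ε k ω) n]
    exact measurable_errorStep (measurable_precision_apply fun k hk => hx k (hsub k hk))
      (measurable_precision_apply hx) (hx _ hmem)
      (ih (fun k hk => hx k (hsub k hk)) (fun k hk => hτ k (hsub k hk))
        (fun k hk => hε k (hsub k hk)))
      ((hτ _ hmem).log.sub (measurable_dotProduct (hx _ hmem) measurable_const))
      ((hε _ hmem).div_const σ)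

lemma measurableSet_isClose {Q : Matrix (Fin K) (Fin K) ℝ} {r : ℝ} {n : ℕ}
    {P : α → Matrix (Fin K) (Fin K) ℝ} (hP : ∀ i j, Measurable fun ω => P ω i j) :
    MeasurableSet {ω | IsClose Q r n (P ω)} := by
  simp only [IsClose, Set.ofPred_forall]
  refine MeasurableSet.iInter fun i => MeasurableSet.iInter fun j => ?_
  have h1 : Measurable fun ω => |P ω i j / n - Q i j| := by
    simpa using (((hP i j).div_const (n : ℝ)).sub_const (Q i j)).norm
  have h2 : Measurable fun ω => |(n : ℝ) * (P ω)⁻¹ i j - Q⁻¹ i j| := by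
    simpa using (((measurable_inv_apply hP i j).const_mul (n : ℝ)).sub_const (Q⁻¹ i j)).norm
  exact (measurableSet_le h1 measurable_const).inter (measurableSet_le h2 measurable_const)

end Measurability

/-! ### Integrating out the fresh error -/

/-- Independence makes the joint law a product, and Tonelli applies. The target of `X` is arbitrary,
so that it can be the sample space itself with a smaller σ-algebra. -/
lemma lintegral_comp_prod_of_indepFun {Ω β γ : Type*} [MeasurableSpace Ω] [MeasurableSpace β]
    [MeasurableSpace γ] {μ : Measure Ω} [IsFiniteMeasure μ] {X : Ω → β} {Z : Ω → γ}
    (hX : Measurable X) (hZ : Measurable Z) (h : IndepFun X Z μ) {f : β × γ → ENNReal}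
    (hf : Measurable f) :
    ∫⁻ ω, f (X ω, Z ω) ∂μ = ∫⁻ ω, ∫⁻ z, f (X ω, z) ∂(μ.map Z) ∂μ := by
  rw [← lintegral_map hf (hX.prodMk hZ),
    (indepFun_iff_map_prod_eq_prod_map_map hX.aemeasurable hZ.aemeasurable).1 h,
    lintegral_prod _ hf.aemeasurable, lintegral_map hf.lintegral_prod_right' hX]

/-- Integrating out a variable `Z` independent of `m`. -/
lemma setLIntegral_le_of_integral_le {Ω : Type*} {m m0 : MeasurableSpace Ω} {μ : Measure Ω}
    [IsFiniteMeasure μ] (hm : m ≤ m0) {Z : Ω → ℝ} (hZ : Measurable Z)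
    (hind : Indep (MeasurableSpace.comap Z inferInstance) m μ) {F : Ω → ℝ → ℝ}
    (hF : Measurable[@Prod.instMeasurableSpace _ _ m _] fun p : Ω × ℝ => F p.1 p.2)
    (hF0 : ∀ ω z, 0 ≤ F ω z) (hFi : ∀ ω, Integrable (F ω) (μ.map Z)) {g : Ω → ℝ} {B : Set Ω}
    (hB : MeasurableSet[m] B) (hle : ∀ ω ∈ B, ∫ z, F ω z ∂(μ.map Z) ≤ g ω) :
    ∫⁻ ω in B, ENNReal.ofReal (F ω (Z ω)) ∂μ ≤ ∫⁻ ω in B, ENNReal.ofReal (g ω) ∂μ := by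
  -- The identity, viewed as a random variable into (Ω, m), carries all the information of `m`;
  -- independence of `Z` from `m` is independence from this map.
  have hX : @Measurable Ω Ω m0 m id := measurable_id.mono hm le_rfl
  have hindep : @IndepFun Ω Ω ℝ m0 m _ id Z μ := by
    refine (@IndepFun_iff_Indep Ω Ω ℝ m0 m _ id Z μ).2 ?_
    rw [@MeasurableSpace.comap_id Ω m]
    exact hind.symm
  have hf : @Measurable (Ω × ℝ) ENNReal (@Prod.instMeasurableSpace _ _ m _) _
      ((Prod.fst ⁻¹' B).indicator fun p => ENNReal.ofReal (F p.1 p.2)) := by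
    have hF' := hF.ennreal_ofReal
    exact hF'.indicator ((@measurable_fst Ω ℝ m _) hB)
  have h := @lintegral_comp_prod_of_indepFun Ω Ω ℝ m0 m _ μ _ id Z hX hZ hindep _ hf
  have e1 : ∀ ω, (Prod.fst ⁻¹' B).indicator (fun p : Ω × ℝ => ENNReal.ofReal (F p.1 p.2))
      (id ω, Z ω) = B.indicator (fun ω => ENNReal.ofReal (F ω (Z ω))) ω := fun ω => by
    by_cases hω : ω ∈ B <;> simp [Set.indicator, hω]
  simp only [e1] at h
  rw [← lintegral_indicator (hm _ hB), ← lintegral_indicator (hm _ hB), h]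
  refine lintegral_mono fun ω => ?_
  by_cases hω : ω ∈ B
  · simp only [Set.indicator, Set.mem_preimage, id, hω, if_true]
    rw [← ofReal_integral_eq_lintegral_ofReal (hFi ω) (Eventually.of_forall (hF0 ω))]
    exact ENNReal.ofReal_le_ofReal (hle ω hω)
  · simp [Set.indicator, hω]

/-! ### Histories and their filtration -/

section History

variable {Ω : Type*} {x : ℕ → Ω → Fin K → ℝ} {τ ε : ℕ → Ω → ℝ}

lemma history_mono : Monotone (history x τ ε) := by
  intro n n' h
  refine sup_le_sup (sup_le_sup ?_ ?_) ?_ <;>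
    exact biSup_mono fun k hk => ⟨hk.1, hk.2.trans (by omega)⟩

lemma history_le [m0 : MeasurableSpace Ω] (hx : ∀ n, Measurable (x n))
    (hτ : ∀ n, Measurable (τ n)) (hε : ∀ n, Measurable (ε n)) (n : ℕ) :
    history x τ ε n ≤ m0 :=
  sup_le (sup_le (iSup₂_le fun k _ => (hx k).comap_le) (iSup₂_le fun k _ => (hτ k).comap_le))
    (iSup₂_le fun k _ => (hε k).comap_le)

lemma measurable_design_history {n k : ℕ} (hk : k ∈ Set.Icc 1 (n + 1)) :
    Measurable[history x τ ε n] (x k) :=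
  measurable_iff_comap_le.2 ((le_biSup (fun k => MeasurableSpace.comap (x k) inferInstance)
    hk).trans (le_sup_left.trans le_sup_left))

lemma measurable_censoring_history {n k : ℕ} (hk : k ∈ Set.Icc 1 (n + 1)) :
    Measurable[history x τ ε n] (τ k) :=
  measurable_iff_comap_le.2 ((le_biSup (fun k => MeasurableSpace.comap (τ k) inferInstance)
    hk).trans (le_sup_right.trans le_sup_left))

lemma measurable_error_history {n k : ℕ} (hk : k ∈ Set.Icc 1 n) :
    Measurable[history x τ ε n] (ε k) :=
  measurable_iff_comap_le.2 ((le_biSup (fun k => MeasurableSpace.comap (ε k) inferInstance)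
    hk).trans le_sup_right)

/-- The filtration of the histories from time `N` on. -/
def historyFiltration [m0 : MeasurableSpace Ω] (hx : ∀ n, Measurable (x n))
    (hτ : ∀ n, Measurable (τ n)) (hε : ∀ n, Measurable (ε n)) (N : ℕ) : Filtration ℕ m0 where
  seq k := history x τ ε (N + k)
  mono' _ _ h := history_mono (Nat.add_le_add_left h N)
  le' _ := history_le hx hτ hε _

end History

lemma integrable_lyapunov_errorStep {σ : ℝ} {Q P P' : Matrix (Fin K) (Fin K) ℝ} (hQ : Q.PosDef)
    (hP : P.PosDef) {x : Fin K → ℝ} (hP' : P' = P + (1 / σ ^ 2) • Matrix.vecMulVec x x)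
    (κ ν a : ℝ) (e : Fin K → ℝ) :
    Integrable (fun z => lyapunov Q κ P' ν (errorStep σ P P' x e a z)) (gaussianReal 0 1) := by
  simp only [errorStep, lyapunov_step_eq hQ hP _ _ _ _ _ hP']
  exact ((integrable_const _).add ((integrable_score _ _ _ _).const_mul _)).add
    ((integrable_score_sq _ _ _ _).const_mul _)

lemma map_div_eq_stdGaussian {Ω : Type*} [MeasurableSpace Ω] {μ : Measure Ω} {σ : ℝ} (hσ : 0 < σ)
    {X : Ω → ℝ} (hX : Measurable X) (hlaw : HasLaw X (gaussianReal 0 (σ ^ 2).toNNReal) μ) :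
    μ.map (fun ω => X ω / σ) = gaussianReal 0 1 := by
  have h := gaussianReal_map_div_const (μ := 0) (v := (σ ^ 2).toNNReal) σ
  rw [← hlaw.map_eq, Measure.map_map (measurable_id'.div_const σ) hX] at h
  refine h.trans ?_
  congr 1
  · simp
  · rw [div_eq_one_iff_eq]
    · ext
      simp [Real.coe_toNNReal _ (sq_nonneg σ)]
    · intro h0
      have := congrArg NNReal.toReal h0
      simp at this
      exact hσ.ne' this

lemma not_summable_const_div_nat_add {c : ℝ} (hc : 0 < c) (N : ℕ) :
    ¬ Summable fun k : ℕ => c / ((N + k + 1 : ℕ) : ℝ) := by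
  intro h
  apply Real.not_summable_one_div_natCast
  rw [← summable_nat_add_iff (N + 1)]
  refine (h.mul_left c⁻¹).congr fun k => ?_
  have e : ((k + (N + 1) : ℕ) : ℝ) = ((N + k + 1 : ℕ) : ℝ) := by push_cast; ring
  rw [e, ← mul_div_assoc, inv_mul_cancel₀ hc.ne']

lemma summable_const_div_nat_add_sq (D : ℝ) (N : ℕ) :
    Summable fun k : ℕ => D / ((N + k + 1 : ℕ) : ℝ) ^ 2 := by
  have h := ((summable_nat_add_iff (N + 1)).2
    (Real.summable_one_div_nat_pow.2 (one_lt_two))).mul_left D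
  refine h.congr fun k => ?_
  have e : ((k + (N + 1) : ℕ) : ℝ) = ((N + k + 1 : ℕ) : ℝ) := by push_cast; ring
  rw [e, mul_one_div]

lemma measurable_lyapunov_errorStep {α : Type*} [MeasurableSpace α] {σ : ℝ}
    {Q : Matrix (Fin K) (Fin K) ℝ} {κ ν : ℝ} {P P' : α → Matrix (Fin K) (Fin K) ℝ}
    {x e : α → Fin K → ℝ} {a : α → ℝ} (hP : ∀ i j, Measurable fun ω => P ω i j)
    (hP' : ∀ i j, Measurable fun ω => P' ω i j) (hx : Measurable x) (he : Measurable e)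
    (ha : Measurable a) :
    Measurable fun p : α × ℝ => lyapunov Q κ (P' p.1) ν
      (errorStep σ (P p.1) (P' p.1) (x p.1) (e p.1) (a p.1) p.2) :=
  measurable_lyapunov (fun i j => (hP' i j).comp measurable_fst)
    (measurable_errorStep (fun i j => (hP i j).comp measurable_fst)
      (fun i j => (hP' i j).comp measurable_fst) (hx.comp measurable_fst)
      (he.comp measurable_fst) (ha.comp measurable_fst) measurable_snd)

/-! ### Contraction along the recursion, localized to good events -/

section Recursion

variable {Ω : Type*} (σ : ℝ) (β θ₀ : Fin K → ℝ) (S₀ Q : Matrix (Fin K) (Fin K) ℝ)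
  (x : ℕ → Ω → Fin K → ℝ) (τ ε : ℕ → Ω → ℝ)

/-- The precision matrices as random matrices. -/
noncomputable def precisionProcess (n : ℕ) (ω : Ω) : Matrix (Fin K) (Fin K) ℝ :=
  precision σ S₀ (fun k => x k ω) n

/-- The estimation error `θₙ - β` as a random vector. -/
noncomputable def errorProcess (n : ℕ) (ω : Ω) : Fin K → ℝ :=
  posteriorMean σ θ₀ S₀ (fun k => x k ω) (fun k => τ k ω)
    (fun k => lifetime β (x k ω) (ε k ω)) n - β

/-- The Lyapunov function along the recursion. -/
noncomputable def lyapunovProcess (κ : ℝ) (n : ℕ) (ω : Ω) : ℝ :=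
  lyapunov Q κ (precisionProcess σ S₀ x n ω) n (errorProcess σ β θ₀ S₀ x τ ε n ω)

/-- Designs and log censoring times are bounded by `M` up to time `n + 1`, the normalized precision
matrices are `r`-close to `Q` from time `N` to `n + 1`, and the Lyapunov function is at most `L` at
time `N`. -/
def goodEvent (κ M r L : ℝ) (N n : ℕ) : Set Ω :=
  {ω | (∀ k ∈ Set.Icc 1 (n + 1), l1Norm (x k ω) ≤ M ∧ |Real.log (τ k ω)| ≤ M) ∧
    (∀ k ∈ Set.Icc N (n + 1), IsClose Q r k (precisionProcess σ S₀ x k ω)) ∧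
    lyapunovProcess σ β θ₀ S₀ Q x τ ε κ N ω ≤ L}

variable {σ β θ₀ S₀ Q x τ ε}

/-- Constraints only accumulate, so the indicator at time n + 1 is dominated by the one at time n,
which the history at n already decides. -/
lemma goodEvent_anti {κ M r L : ℝ} {N : ℕ} :
    Antitone (goodEvent σ β θ₀ S₀ Q x τ ε κ M r L N) := fun _ _ h _ hω =>
  ⟨fun k hk => hω.1 k ⟨hk.1, hk.2.trans (by omega)⟩,
    fun k hk => hω.2.1 k ⟨hk.1, hk.2.trans (by omega)⟩, hω.2.2⟩

lemma measurable_precisionProcess_history {n k : ℕ} (hk : k ≤ n + 1) (i j : Fin K) :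
    Measurable[history x τ ε n] fun ω => precisionProcess σ S₀ x k ω i j :=
  @measurable_precision_apply K Ω (history x τ ε n) σ S₀ x k
    (fun _ hl => measurable_design_history ⟨hl.1, hl.2.trans hk⟩) i j

lemma measurable_errorProcess_history (hσ : 0 < σ) (hτ_pos : ∀ n ω, 0 < τ n ω) {n k : ℕ}
    (hk : k ≤ n) : Measurable[history x τ ε n] (errorProcess σ β θ₀ S₀ x τ ε k) :=
  @measurable_posteriorMean_sub K Ω (history x τ ε n) σ hσ β θ₀ S₀ x τ ε hτ_pos k
    (fun _ hl => measurable_design_history ⟨hl.1, (hl.2.trans hk).trans n.le_succ⟩)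
    (fun _ hl => measurable_censoring_history ⟨hl.1, (hl.2.trans hk).trans n.le_succ⟩)
    (fun _ hl => measurable_error_history ⟨hl.1, hl.2.trans hk⟩)

lemma measurable_lyapunovProcess_history (hσ : 0 < σ) (hτ_pos : ∀ n ω, 0 < τ n ω) {κ : ℝ}
    {n k : ℕ} (hk : k ≤ n) :
    Measurable[history x τ ε n] (lyapunovProcess σ β θ₀ S₀ Q x τ ε κ k) :=
  @measurable_lyapunov K Ω (history x τ ε n) Q κ k _ _
    (measurable_precisionProcess_history (hk.trans n.le_succ))
    (measurable_errorProcess_history hσ hτ_pos hk)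

/-- The history at n contains x_{n+1} and τ_{n+1}, hence determines P_{n+1}. The event may therefore
look one step ahead, as the contraction needs both P_n and P_{n+1} close to Q. -/
lemma measurableSet_goodEvent (hσ : 0 < σ) (hτ_pos : ∀ n ω, 0 < τ n ω) {κ M r L : ℝ} {N n : ℕ}
    (hN : N ≤ n) :
    MeasurableSet[history x τ ε n] (goodEvent σ β θ₀ S₀ Q x τ ε κ M r L N n) := by
  have h1 : ∀ k ∈ Set.Icc 1 (n + 1), MeasurableSet[history x τ ε n]
      {ω | l1Norm (x k ω) ≤ M ∧ |Real.log (τ k ω)| ≤ M} := fun k hk => by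
    have hx : Measurable[history x τ ε n] fun ω => l1Norm (x k ω) :=
      continuous_l1Norm.measurable.comp (measurable_design_history hk)
    have hτ : Measurable[history x τ ε n] fun ω => |Real.log (τ k ω)| :=
      continuous_abs.measurable.comp
        (Real.measurable_log.comp (measurable_censoring_history hk))
    exact (hx measurableSet_Iic).inter (hτ measurableSet_Iic)
  have h2 : ∀ k ∈ Set.Icc N (n + 1), MeasurableSet[history x τ ε n]
      {ω | IsClose Q r k (precisionProcess σ S₀ x k ω)} := fun k hk =>
    @measurableSet_isClose K Ω (history x τ ε n) Q r k _
      (measurable_precisionProcess_history hk.2)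
  have h3 : MeasurableSet[history x τ ε n] {ω | lyapunovProcess σ β θ₀ S₀ Q x τ ε κ N ω ≤ L} :=
    measurable_lyapunovProcess_history hσ hτ_pos hN measurableSet_Iic
  have e : goodEvent σ β θ₀ S₀ Q x τ ε κ M r L N n
      = (⋂ k ∈ Set.Icc 1 (n + 1), {ω | l1Norm (x k ω) ≤ M ∧ |Real.log (τ k ω)| ≤ M}) ∩
        ((⋂ k ∈ Set.Icc N (n + 1), {ω | IsClose Q r k (precisionProcess σ S₀ x k ω)}) ∩
        {ω | lyapunovProcess σ β θ₀ S₀ Q x τ ε κ N ω ≤ L}) := by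
    ext ω
    simp [goodEvent]
  rw [e]
  exact (MeasurableSet.biInter (Set.to_countable _) h1).inter
    ((MeasurableSet.biInter (Set.to_countable _) h2).inter h3)

lemma errorProcess_succ (hσ : 0 < σ) (hτ_pos : ∀ n ω, 0 < τ n ω) (n : ℕ) (ω : Ω) :
    errorProcess σ β θ₀ S₀ x τ ε (n + 1) ω
      = errorStep σ (precisionProcess σ S₀ x n ω) (precisionProcess σ S₀ x (n + 1) ω)
          (x (n + 1) ω) (errorProcess σ β θ₀ S₀ x τ ε n ω)
          (Real.log (τ (n + 1) ω) - x (n + 1) ω ⬝ᵥ β) (ε (n + 1) ω / σ) :=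
  posteriorMean_succ_sub hσ β θ₀ S₀ (fun k => x k ω) (fun k => hτ_pos k ω) (fun k => ε k ω) n

lemma lyapunovProcess_nonneg (hS₀ : S₀.PosDef) (hQ : Q.PosDef) {κ : ℝ} (hκ : 0 ≤ κ) (n : ℕ)
    (ω : Ω) : 0 ≤ lyapunovProcess σ β θ₀ S₀ Q x τ ε κ n ω :=
  lyapunov_nonneg hQ (precision_posDef hS₀ _ n) hκ n.cast_nonneg _

variable [m0 : MeasurableSpace Ω] {μ : Measure Ω} [IsProbabilityMeasure μ]

/-- On the good events the Lyapunov function tends to zero. -/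
lemma ae_tendsto_indicator_lyapunovProcess (hσ : 0 < σ) (hS₀ : S₀.PosDef) (hQ : Q.PosDef)
    (hx : ∀ n, Measurable (x n)) (hτ : ∀ n, Measurable (τ n)) (hε : ∀ n, Measurable (ε n))
    (hτ_pos : ∀ n ω, 0 < τ n ω)
    (hε_law : ∀ n, HasLaw (ε (n + 1)) (gaussianReal 0 (σ ^ 2).toNNReal) μ)
    (hε_indep : ∀ n, Indep (MeasurableSpace.comap (ε (n + 1)) inferInstance)
      (history x τ ε n) μ)
    {κ c D r M : ℝ} (L : ℝ) {N₀ N : ℕ} (hκ : 0 < κ) (hc : 0 < c) (hD : 0 ≤ D) (hc1 : c ≤ 1)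
    (hN : N₀ ≤ N)
    (hcon : ∀ n, N₀ ≤ n → ∀ (P P' : Matrix (Fin K) (Fin K) ℝ) (x e : Fin K → ℝ) (a : ℝ),
        P.PosDef → P' = P + (1 / σ ^ 2) • Matrix.vecMulVec x x → l1Norm x ≤ M →
        |a| ≤ M + M * l1Norm β → IsClose Q r n P → IsClose Q r (n + 1) P' →
        ∫ z, lyapunov Q κ P' (n + 1 : ℕ) (errorStep σ P P' x e a z) ∂gaussianReal 0 1
          ≤ (1 - c / (n + 1 : ℕ)) * lyapunov Q κ P n e + D / ((n + 1 : ℕ) : ℝ) ^ 2) :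
    ∀ᵐ ω ∂μ, Tendsto (fun k => (goodEvent σ β θ₀ S₀ Q x τ ε κ M r L N (N + k)).indicator
      (lyapunovProcess σ β θ₀ S₀ Q x τ ε κ (N + k)) ω) atTop (𝓝 0) := by
  set W := lyapunovProcess σ β θ₀ S₀ Q x τ ε κ with hW
  set G := goodEvent σ β θ₀ S₀ Q x τ ε κ M r L N with hG
  have hW0 : ∀ n ω, 0 ≤ W n ω := lyapunovProcess_nonneg hS₀ hQ hκ.le
  have hcn : ∀ n : ℕ, c / ((n + 1 : ℕ) : ℝ) ≤ 1 := fun n =>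
    (div_le_one (by positivity)).2 (hc1.trans (by push_cast; linarith [n.cast_nonneg (α := ℝ)]))
  have hadp : ∀ k, Measurable[history x τ ε (N + k)] ((G (N + k)).indicator (W (N + k))) :=
    fun k => Measurable.indicator (measurable_lyapunovProcess_history hσ hτ_pos le_rfl)
      (measurableSet_goodEvent hσ hτ_pos (Nat.le_add_right N k))
  refine ae_tendsto_zero_of_contraction (historyFiltration hx hτ hε N)
    (Y := fun k => (G (N + k)).indicator (W (N + k)))
    (a := fun k => c / ((N + k + 1 : ℕ) : ℝ)) (b := fun k => D / ((N + k + 1 : ℕ) : ℝ) ^ 2)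
    (fun k => (hadp k).stronglyMeasurable)
    (fun k ω => Set.indicator_nonneg (fun ω _ => hW0 _ ω) ω) ?_
    (fun k => by positivity) (fun k => hcn _) (fun k => by positivity)
    (not_summable_const_div_nat_add hc N) (summable_const_div_nat_add_sq D N) ?_
  -- The level `L` in the good event serves only to make the initial variable bounded.
  · refine Integrable.of_bound (C := |L|)
      ((hadp 0).mono (history_le hx hτ hε _) le_rfl).aestronglyMeasurable
      (Eventually.of_forall fun ω => ?_)
    by_cases hω : ω ∈ G (N + 0)
    · rw [Set.indicator_of_mem hω, Real.norm_of_nonneg (hW0 _ _)]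
      exact hω.2.2.trans (le_abs_self L)
    · rw [Set.indicator_of_notMem hω, norm_zero]
      exact abs_nonneg L
  · intro k B hB
    set n := N + k with hn
    change MeasurableSet[history x τ ε n] B at hB
    have hGn : MeasurableSet[history x τ ε n] (G n) :=
      measurableSet_goodEvent hσ hτ_pos (Nat.le_add_right N k)
    have hle := history_le hx hτ hε n
    have hmap := map_div_eq_stdGaussian hσ (hε (n + 1)) (hε_law n)
    -- The next Lyapunov value as a function of the past and of a free standardized error `z`.
    set F : Ω → ℝ → ℝ := fun ω z => lyapunov Q κ (precisionProcess σ S₀ x (n + 1) ω) (n + 1 : ℕ)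
      (errorStep σ (precisionProcess σ S₀ x n ω) (precisionProcess σ S₀ x (n + 1) ω)
          (x (n + 1) ω) (errorProcess σ β θ₀ S₀ x τ ε n ω)
          (Real.log (τ (n + 1) ω) - x (n + 1) ω ⬝ᵥ β) z) with hF
    have hFW : ∀ ω, F ω (ε (n + 1) ω / σ) = W (n + 1) ω := fun ω => by
      rw [hW, lyapunovProcess, errorProcess_succ hσ hτ_pos]
    have hPd : ∀ n ω, (precisionProcess σ S₀ x n ω).PosDef := fun n ω =>
      precision_posDef hS₀ _ n
    have hind : Indep (MeasurableSpace.comap (fun ω => ε (n + 1) ω / σ) inferInstance)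
        (history x τ ε n) μ := by
      refine indep_of_indep_of_le_left (hε_indep n) ?_
      have : (fun ω => ε (n + 1) ω / σ) = (fun t => t / σ) ∘ ε (n + 1) := rfl
      rw [this, ← MeasurableSpace.comap_comp]
      exact MeasurableSpace.comap_mono (measurable_id.div_const σ).comap_le
    have hmem : n + 1 ∈ Set.Icc 1 (n + 1) := ⟨by omega, le_rfl⟩
    have hFm : Measurable[@Prod.instMeasurableSpace _ _ (history x τ ε n) _]
        fun p : Ω × ℝ => F p.1 p.2 := by
      have ha : Measurable[history x τ ε n]
          fun ω => Real.log (τ (n + 1) ω) - x (n + 1) ω ⬝ᵥ β :=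
        (Real.measurable_log.comp (measurable_censoring_history hmem)).sub
          (@measurable_dotProduct K Ω (history x τ ε n) _ _ (measurable_design_history hmem)
            (@measurable_const _ _ _ (history x τ ε n) β))
      exact @measurable_lyapunov_errorStep K Ω (history x τ ε n) σ Q κ (n + 1 : ℕ)
        (precisionProcess σ S₀ x n) (precisionProcess σ S₀ x (n + 1)) (x (n + 1))
        (errorProcess σ β θ₀ S₀ x τ ε n) (fun ω => Real.log (τ (n + 1) ω) - x (n + 1) ω ⬝ᵥ β)
        (measurable_precisionProcess_history n.le_succ)
        (measurable_precisionProcess_history le_rfl) (measurable_design_history hmem)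
        (measurable_errorProcess_history hσ hτ_pos le_rfl) ha
    have hstep : ∀ ω ∈ B ∩ G n, ∫ z, F ω z ∂(μ.map fun ω => ε (n + 1) ω / σ)
        ≤ (1 - c / ((n + 1 : ℕ) : ℝ)) * W n ω + D / ((n + 1 : ℕ) : ℝ) ^ 2 := by
      rintro ω ⟨-, hω⟩
      rw [hmap]
      obtain ⟨hxM, hτM⟩ := hω.1 (n + 1) hmem
      refine hcon n (hN.trans (Nat.le_add_right N k)) _ _ _ _ _ (hPd n ω) rfl hxM ?_
        (hω.2.1 n ⟨Nat.le_add_right N k, n.le_succ⟩)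
        (hω.2.1 (n + 1) ⟨(Nat.le_add_right N k).trans n.le_succ, le_rfl⟩)
      exact (abs_sub _ _).trans (add_le_add hτM ((abs_dotProduct_le _ _).trans
        (mul_le_mul_of_nonneg_right hxM (l1Norm_nonneg β))))
    have hmain := setLIntegral_le_of_integral_le hle ((hε (n + 1)).div_const σ) hind hFm
      (fun ω z => lyapunov_nonneg hQ (hPd _ _) hκ.le (Nat.cast_nonneg _) _)
      (fun ω => hmap ▸ integrable_lyapunov_errorStep hQ (hPd n ω) rfl κ _ _ _)
      (hB.inter hGn) hstep
    simp only [hFW] at hmain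
    have hG' : G (n + 1) ⊆ G n := goodEvent_anti n.le_succ
    calc ∫⁻ ω in B, ENNReal.ofReal ((G (n + 1)).indicator (W (n + 1)) ω) ∂μ
        ≤ ∫⁻ ω in B, (G n).indicator (fun ω => ENNReal.ofReal (W (n + 1) ω)) ω ∂μ := by
          refine lintegral_mono fun ω => ?_
          by_cases hω : ω ∈ G (n + 1)
          · rw [Set.indicator_of_mem hω, Set.indicator_of_mem (hG' hω)]
          · rw [Set.indicator_of_notMem hω, ENNReal.ofReal_zero]
            exact zero_le
      _ = ∫⁻ ω in B ∩ G n, ENNReal.ofReal (W (n + 1) ω) ∂μ := by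
          rw [lintegral_indicator (hle _ hGn), Measure.restrict_restrict (hle _ hGn),
            Set.inter_comm]
      _ ≤ ∫⁻ ω in B ∩ G n, ENNReal.ofReal
          ((1 - c / ((n + 1 : ℕ) : ℝ)) * W n ω + D / ((n + 1 : ℕ) : ℝ) ^ 2) ∂μ := hmain
      _ = ∫⁻ ω in B ∩ G n, ENNReal.ofReal ((1 - c / ((n + 1 : ℕ) : ℝ)) *
          (G n).indicator (W n) ω + D / ((n + 1 : ℕ) : ℝ) ^ 2) ∂μ := by
          refine setLIntegral_congr_fun (hle _ (hB.inter hGn)) fun ω hω => ?_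
          simp only [Set.indicator_of_mem hω.2]
      _ ≤ _ := lintegral_mono_set Set.inter_subset_left

end Recursion

/-! ### Law of large numbers and conclusion -/

/-- A random vector with positive definite second moment matrix has integrable products of
coordinates. -/
lemma integrable_mul_of_secondMoment_posDef {Ω : Type*} [MeasurableSpace Ω] {μ : Measure Ω}
    {X : Ω → Fin K → ℝ} (hX : Measurable X) (h : (secondMoment μ X).PosDef) (i j : Fin K) :
    Integrable (fun ω => X ω i * X ω j) μ := by
  have hm : ∀ i, Measurable fun ω => X ω i := fun i => (measurable_pi_apply i).comp hX
  have hsq : ∀ i, MemLp (fun ω => X ω i) 2 μ := fun i => by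
    rw [memLp_two_iff_integrable_sq (hm i).aestronglyMeasurable]
    by_contra hni
    have hpos := h.diag_pos (i := i)
    simp only [secondMoment, Matrix.of_apply, ← pow_two] at hpos
    -- A square that is not integrable has integral 0 by convention, contradicting the positive
    -- diagonal entry.
    rw [integral_undef hni] at hpos
    exact lt_irrefl _ hpos
  exact (hsq i).integrable_mul (hsq j)

/-- The strong law of large numbers for the precision matrices. -/
lemma ae_tendsto_precision_div {Ω : Type*} [MeasurableSpace Ω] {μ : Measure Ω}
    {σ : ℝ} {S₀ A : Matrix (Fin K) (Fin K) ℝ} (hA : A.PosDef) {x : ℕ → Ω → Fin K → ℝ}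
    (hx : ∀ n, Measurable (x n)) (hx_indep : iIndepFun x μ)
    (hx_ident : ∀ n, IdentDistrib (x n) (x 0) μ μ) (hx_moment : ∀ n, secondMoment μ (x n) = A) :
    ∀ᵐ ω ∂μ, ∀ i j, Tendsto (fun n : ℕ => precision σ S₀ (fun k => x k ω) n i j / n) atTop
      (𝓝 (((1 / σ ^ 2) • A) i j)) := by
  refine ae_all_iff.2 fun i => ae_all_iff.2 fun j => ?_
  have hφ : Measurable fun v : Fin K → ℝ => v i * v j :=
    (measurable_pi_apply i).mul (measurable_pi_apply j)
  -- The index is shifted because x_0 never enters the recursion; the prior contributes S₀⁻¹/n → 0.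
  have h := strong_law_ae_real (μ := μ) (fun n ω => x (n + 1) ω i * x (n + 1) ω j)
    (integrable_mul_of_secondMoment_posDef (hx 1) (hx_moment 1 ▸ hA) i j)
    (fun m n hmn => (hx_indep.indepFun (by simpa using hmn : m + 1 ≠ n + 1)).comp hφ hφ)
    (fun n => ((hx_ident (n + 1)).trans (hx_ident 1).symm).comp hφ)
  have hAij : ∫ ω, x (0 + 1) ω i * x (0 + 1) ω j ∂μ = A i j := by
    rw [← hx_moment 1]; rfl
  rw [hAij] at h
  filter_upwards [h] with ω hω
  have h1 := (tendsto_const_div_atTop_nhds_zero_nat (S₀⁻¹ i j)).add (hω.const_mul (1 / σ ^ 2))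
  rw [zero_add] at h1
  rw [Matrix.smul_apply, smul_eq_mul]
  refine h1.congr fun n => ?_
  rw [precision_apply]
  ring

/-- An integer bound allows all bounds to be treated at once through a countable family of almost
sure statements. -/
lemma exists_nat_bound {x : ℕ → Fin K → ℝ} {τ : ℕ → ℝ}
    (hx : BddAbove (Set.range fun n => l1Norm (x n))) (hτ : ∃ M : ℝ, ∀ n, |Real.log (τ n)| ≤ M) :
    ∃ M : ℕ, ∀ n, l1Norm (x n) ≤ M ∧ |Real.log (τ n)| ≤ M := by
  obtain ⟨C, hC⟩ := hx
  obtain ⟨B, hB⟩ := hτ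
  obtain ⟨M, hM⟩ := exists_nat_ge (max C B)
  exact ⟨M, fun n => ⟨(hC ⟨n, rfl⟩).trans ((le_max_left _ _).trans hM),
    (hB n).trans ((le_max_right _ _).trans hM)⟩⟩

/-- Coercivity of the Lyapunov function turns its convergence into that of the error. -/
lemma tendsto_zero_of_tendsto_lyapunov {Q : Matrix (Fin K) (Fin K) ℝ} (hQ : Q.PosDef) {κ : ℝ}
    (hκ : 0 ≤ κ) {P : ℕ → Matrix (Fin K) (Fin K) ℝ} (hP : ∀ n, (P n).PosDef)
    {e : ℕ → Fin K → ℝ} (h : Tendsto (fun n : ℕ => lyapunov Q κ (P n) n (e n)) atTop (𝓝 0)) :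
    Tendsto e atTop (𝓝 0) := by
  obtain ⟨l, hl, hcoer⟩ := exists_coercive hQ
  refine tendsto_pi_nhds.2 fun i => ?_
  have h1 : Tendsto (fun n => e n i ^ 2) atTop (𝓝 0) := by
    have h2 := h.const_mul l⁻¹
    rw [mul_zero] at h2
    refine squeeze_zero (fun n => sq_nonneg _) (fun n => ?_) h2
    have h3 : 0 ≤ κ / (n : ℝ) * e n ⬝ᵥ (P n *ᵥ e n) :=
      mul_nonneg (div_nonneg hκ n.cast_nonneg) (dotProduct_mulVec_nonneg (hP n) _)
    have h4 : e n i ^ 2 ≤ l1Norm (e n) ^ 2 :=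
      sq_le_sq.2 ((abs_apply_le_l1Norm _ i).trans (le_abs_self _))
    rw [inv_mul_eq_div, le_div_iff₀ hl, lyapunov]
    nlinarith [hcoer (e n), mul_le_mul_of_nonneg_left h4 hl.le]
  have h5 := h1.sqrt
  simp only [Real.sqrt_sq_eq_abs, Real.sqrt_zero] at h5
  exact tendsto_zero_iff_abs_tendsto_zero _ |>.2 h5

/-- Consistency on the event that designs and log censoring times are bounded by `M`. -/
theorem ae_tendsto_posteriorMean_of_bound {Ω : Type*} [MeasurableSpace Ω] {μ : Measure Ω}
    [IsProbabilityMeasure μ] (β θ₀ : Fin K → ℝ) {σ : ℝ} (hσ : 0 < σ)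
    {S₀ Q : Matrix (Fin K) (Fin K) ℝ} (hS₀ : S₀.PosDef) (hQ : Q.PosDef)
    {x : ℕ → Ω → Fin K → ℝ} {τ ε : ℕ → Ω → ℝ}
    (hx : ∀ n, Measurable (x n)) (hτ : ∀ n, Measurable (τ n)) (hε : ∀ n, Measurable (ε n))
    (hτ_pos : ∀ n ω, 0 < τ n ω)
    (hε_law : ∀ n, HasLaw (ε (n + 1)) (gaussianReal 0 (σ ^ 2).toNNReal) μ)
    (hε_indep : ∀ n, Indep (MeasurableSpace.comap (ε (n + 1)) inferInstance)
      (history x τ ε n) μ)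
    (hprec : ∀ᵐ ω ∂μ, ∀ i j, Tendsto (fun n : ℕ => precision σ S₀ (fun k => x k ω) n i j / n) atTop
      (𝓝 (Q i j))) (M : ℕ) :
    ∀ᵐ ω ∂μ, (∀ n, l1Norm (x n ω) ≤ M ∧ |Real.log (τ n ω)| ≤ M) →
      Tendsto (fun n => posteriorMean σ θ₀ S₀ (fun k => x k ω) (fun k => τ k ω)
        (fun k => lifetime β (x k ω) (ε k ω)) n) atTop (𝓝 β) := by
  have hM : (0 : ℝ) ≤ M := M.cast_nonneg
  -- The second bound is for log τ − xᵀβ, whose size is at most M + M‖β‖₁.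
  obtain ⟨κ, c, D, r, N₀, hκ, hc, hD, hr, hc1, hcon⟩ := exists_contraction hσ hQ hM
    (add_nonneg hM (mul_nonneg hM (l1Norm_nonneg β)))
  have hconv : ∀ᵐ ω ∂μ, ∀ N L : ℕ, N₀ ≤ N → Tendsto (fun k =>
      (goodEvent σ β θ₀ S₀ Q x τ ε κ M r L N (N + k)).indicator
        (lyapunovProcess σ β θ₀ S₀ Q x τ ε κ (N + k)) ω) atTop (𝓝 0) := by
    refine ae_all_iff.2 fun N => ae_all_iff.2 fun L => ?_
    by_cases hN : N₀ ≤ N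
    · filter_upwards [ae_tendsto_indicator_lyapunovProcess (β := β) (θ₀ := θ₀) hσ hS₀ hQ hx hτ hε
        hτ_pos hε_law hε_indep L hκ hc hD hc1 hN hcon] with ω hω _ using hω
    · exact Eventually.of_forall fun ω h => absurd h hN
  filter_upwards [hconv, hprec] with ω hω hω' hbound
  -- For this path, choose `N` after which the precisions stay close to `Q`, then `L` above the
  -- Lyapunov value at `N`; the path lies in every later good event, so the indicators equal 1.
  obtain ⟨N₁, hN₁⟩ := eventually_atTop.1 (eventually_isClose hQ hω' hr)
  set N := max N₀ N₁ with hN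
  obtain ⟨L, hL⟩ := exists_nat_ge (lyapunovProcess σ β θ₀ S₀ Q x τ ε κ N ω)
  have hgood : ∀ k, ω ∈ goodEvent σ β θ₀ S₀ Q x τ ε κ M r L N (N + k) := fun k =>
    ⟨fun j _ => hbound j, fun j hj => hN₁ j ((le_max_right _ _).trans hj.1), hL⟩
  have h1 := hω N L (le_max_left _ _)
  simp only [Set.indicator_of_mem (hgood _)] at h1
  have h2 : Tendsto (fun n => lyapunovProcess σ β θ₀ S₀ Q x τ ε κ n ω) atTop (𝓝 0) := by
    rw [← tendsto_add_atTop_iff_nat N]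
    exact h1.congr fun k => by rw [add_comm]
  have h3 := tendsto_zero_of_tendsto_lyapunov hQ hκ.le (fun n => precision_posDef hS₀ _ n) h2
  have h4 := h3.add_const β
  rw [zero_add] at h4
  exact h4.congr fun n => by simp [errorProcess]

end CensoredLogNormal

theorem theorem1 {Ω : Type*} [MeasurableSpace Ω] (μ : Measure Ω) [IsProbabilityMeasure μ]
    {K : ℕ} (β θ₀ : Fin K → ℝ) (σ : ℝ) (hσ : 0 < σ)
    (S₀ A : Matrix (Fin K) (Fin K) ℝ) (hS₀ : S₀.PosDef) (hA : A.PosDef)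
    (x : ℕ → Ω → Fin K → ℝ) (τ ε : ℕ → Ω → ℝ)
    (hx : ∀ n, Measurable (x n)) (hτ : ∀ n, Measurable (τ n)) (hε : ∀ n, Measurable (ε n))
    -- the designs are i.i.d. with second moment matrix `A`
    (hx_indep : iIndepFun x μ) (hx_ident : ∀ n, IdentDistrib (x n) (x 0) μ μ)
    (hx_moment : ∀ n, CensoredLogNormal.secondMoment μ (x n) = A)
    -- their norms are almost surely bounded, and bounded away from zero
    (hx_bound : ∀ᵐ ω ∂μ, 0 < (⨅ n, CensoredLogNormal.l1Norm (x n ω)) ∧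
      BddAbove (Set.range fun n => CensoredLogNormal.l1Norm (x n ω)))
    -- the censoring times are positive and their logarithms are bounded
    (hτ_pos : ∀ n ω, 0 < τ n ω)
    (hτ_bound : ∀ᵐ ω ∂μ, ∃ M : ℝ, ∀ n, |Real.log (τ n ω)| ≤ M)
    -- the errors are `N(0, σ²)`, each independent of everything known before its test
    (hε_law : ∀ n, HasLaw (ε (n + 1)) (gaussianReal 0 (σ ^ 2).toNNReal) μ)
    (hε_indep : ∀ n, Indep (MeasurableSpace.comap (ε (n + 1)) inferInstance)
      (CensoredLogNormal.history x τ ε n) μ) :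
    ∀ᵐ ω ∂μ, Tendsto
      (fun n => CensoredLogNormal.posteriorMean σ θ₀ S₀ (fun k => x k ω) (fun k => τ k ω)
        (fun k => CensoredLogNormal.lifetime β (x k ω) (ε k ω)) n)
      atTop (𝓝 β) := by
  -- The almost sure limit of Σ_n⁻¹/n.
  have hQ : ((1 / σ ^ 2) • A).PosDef := hA.smul (by positivity)
  have hprec := CensoredLogNormal.ae_tendsto_precision_div (σ := σ) (S₀ := S₀) hA hx hx_indep
    hx_ident hx_moment
  filter_upwards [hx_bound, hτ_bound, ae_all_iff.2 fun M =>
    CensoredLogNormal.ae_tendsto_posteriorMean_of_bound β θ₀ hσ hS₀ hQ hx hτ hε hτ_pos hε_law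
      hε_indep hprec M] with ω hω₁ hω₂ hω
  obtain ⟨M, hM⟩ := CensoredLogNormal.exists_nat_bound hω₁.2 hω₂
  exact hω M hM
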